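/- Let $G = SU(2)\times SU(2)$, and let $\alpha_i, e_i^+, e_i^-$ ($i=1,2$, one triple for each factor) be the basis of left-invariant real 1-forms on $G$ satisfying the Maurer–Cartan equations $$d\alpha_i = e_i^-\wedge e_i^+,\qquad de_i^+ = \alpha_i\wedge e_i^-,\qquad de_i^- = -\alpha_i\wedge e_i^+ .$$ (Explicitly, identifying $SU(2)$ with the group of unit quaternions $q$, take $\alpha_i, e_i^-, e_i^+$ to be $-2$ times the $\mathbf i,\mathbf j,\mathbf k$-components of the left-invariant form $q^{-1}dq$ of the $i$-th factor.) Let $a,b\in\mathbb R$ with $b\neq 0$, put $c=-\frac{a^2+1}{b}$, and let $J$ be the left-invariant complex structure on $G$ determined by $$J\alpha_1 = a\alpha_1+b\alpha_2,\quad J\alpha_2 = c\,\alpha_1-a\alpha_2,\quad J e_i^+=e_i^-,\quad J e_i^-=-e_i^+ \qquad (i=1,2),$$ where $(J\xi)(X)=\xi(JX)$ for a 1-form $\xi$ and a tangent vector $X$. A Riemannian metric $g$ with $g(JX,JY)=g(X,Y)$ is called CYT (Calabi–Yau with torsion) if the Ricci form $\rho^B(X,Y)=\sum_k g(R^B(X,Y)E_k,JE_k)$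 vanishes, where $(E_k)$ is a local $g$-orthonormal frame and $R^B$ is the curvature of the Bismut connection of $(g,J)$, that is, the unique linear connection with $\nabla g=0$, $\nabla J=0$ and totally skew-symmetric torsion. Then there is a left-invariant CYT metric on $(G,J)$ if and only if $$b(b-a)>0\quad\text{and}\quad a^2+1-ab>0 .$$ -/

import Mathlib

open scoped Manifold ContDiff Quaternion Bundle

noncomputable section

namespace CYT

/-! ### Connections with skew torsion and the CYT condition on a manifold -/

section Geometry

variable {E : Type*} [NormedAddCommGroup E] [NormedSpace ℝ E] [FiniteDimensional ℝ E]
  {H : Type*} [TopologicalSpace H] (I : ModelWithCorners ℝ E H)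
  (M : Type*) [TopologicalSpace M] [ChartedSpace H M] [IsManifold I ∞ M]

/-- (Not necessarily continuous) vector fields on `M`. -/
abbrev VField : Type _ := (x : M) → TangentSpace I x

/-- Fields of endomorphisms of the tangent spaces of `M`. -/
abbrev EndField : Type _ := (x : M) → TangentSpace I x →L[ℝ] TangentSpace I x

/-- Smooth Riemannian metrics on `M`. -/
abbrev SmoothMetric : Type _ :=
  Bundle.ContMDiffRiemannianMetric I ∞ E (TangentSpace I : M → Type _)

/-- Linear connections on `M`. On differentiable fields, `D Y x (X x)` is `(∇_X Y)(x)`. -/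
abbrev Connection : Type _ := CovariantDerivative I E (TangentSpace I : M → Type _)

variable {I M}

/-- The vector field `X` is smooth. -/
def SmoothField (X : VField I M) : Prop :=
  ContMDiff I I.tangent ∞ (fun x ↦ (⟨x, X x⟩ : TangentBundle I M))

/-- The metric is Hermitian with respect to `J`: `g(JX, JY) = g(X, Y)`. -/
def IsHermitian (J : EndField I M) (g : SmoothMetric I M) : Prop :=
  ∀ (x : M) (u v : TangentSpace I x), g.inner x (J x u) (J x v) = g.inner x u v

/-- `D` is the Bismut (Kähler-with-torsion) connection of the Hermitian structure `(J, g)`: the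
unique connection with `∇g = 0`, `∇J = 0` and totally skew-symmetric torsion. Torsion is always
skew in its first two arguments, so it is enough to ask that `g(T(X, Y), Z)` be skew in `Y, Z`. -/
structure IsBismut (J : EndField I M) (g : SmoothMetric I M) (D : Connection I M) : Prop where
  metric : ∀ Y Z : VField I M, SmoothField Y → SmoothField Z →
    ∀ (x : M) (u : TangentSpace I x),
      mvfderiv I (fun y ↦ g.inner y (Y y) (Z y)) x u =
        g.inner x (D Y x u) (Z x) + g.inner x (Y x) (D Z x u)
  complex : ∀ Y : VField I M, SmoothField Y →
    ∀ (x : M) (u : TangentSpace I x), D (fun y ↦ J y (Y y)) x u = J x (D Y x u)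
  skew : ∀ (x : M) (u v w : TangentSpace I x),
    g.inner x (D.torsion x u v) w = - g.inner x (D.torsion x u w) v

/-- The curvature `R(X, Y)Z = ∇_X ∇_Y Z - ∇_Y ∇_X Z - ∇_[X, Y] Z`. -/
def curvature (D : Connection I M) (X Y Z : VField I M) : VField I M := fun x ↦
  D (fun y ↦ D Z y (Y y)) x (X x) - D (fun y ↦ D Z y (X y)) x (Y x)
    - D Z x (VectorField.mlieBracket I X Y x)

/-- The Ricci form `ρ(X, Y) = ∑ᵢ g(R(X, Y)Eᵢ, J Eᵢ)` of the connection `D` vanishes; at each point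
`x` the sum runs over smooth fields `Eᵢ` whose values at `x` form a `g`-orthonormal basis of the
tangent space. -/
def RicciFormVanishes (J : EndField I M) (g : SmoothMetric I M) (D : Connection I M) : Prop :=
  ∀ X Y : VField I M, SmoothField X → SmoothField Y → ∀ x : M,
    ∀ e : Fin (Module.finrank ℝ E) → VField I M, (∀ i, SmoothField (e i)) →
      (∀ i j, g.inner x (e i x) (e j x) = if i = j then 1 else 0) →
      ∑ i, g.inner x (curvature D X Y (e i) x) (J x (e i x)) = 0

/-- `g` is a CYT (Calabi-Yau with torsion) metric on `(M, J)`: it is Hermitian and the Ricci form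
of its Bismut connection vanishes. -/
def IsCYT (J : EndField I M) (g : SmoothMetric I M) : Prop :=
  IsHermitian J g ∧ ∃ D : Connection I M, IsBismut J g D ∧ RicciFormVanishes J g D

/-- The metric is invariant under the left translations of the group `M`. -/
def IsLeftInvariant [Group M] (g : SmoothMetric I M) : Prop :=
  ∀ (h x : M) (u v : TangentSpace I x),
    g.inner (h * x) (mfderiv I I (fun y ↦ h * y) x u) (mfderiv I I (fun y ↦ h * y) x v) =
      g.inner x u v

end Geometry

/-! ### The Lie group `SU(2)`, realized as the group of unit quaternions -/

instance finrank_quaternion_fact : Fact (Module.finrank ℝ ℍ[ℝ] = 3 + 1) :=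
  ⟨Quaternion.finrank_eq_four⟩

/-- The Lie group `SU(2)`, as the unit sphere of the quaternions, with quaternion multiplication
and the smooth structure of the sphere; see `su2Equiv`. -/
abbrev SU2 : Type := Metric.sphere (0 : ℍ[ℝ]) 1

instance : LieGroup (𝓡 3) ω SU2 where
  contMDiff_mul := by
    apply ContMDiff.codRestrict_sphere
    let c : SU2 → ℍ[ℝ] := (↑)
    have h₂ : ContMDiff (𝓘(ℝ, ℍ[ℝ]).prod 𝓘(ℝ, ℍ[ℝ])) 𝓘(ℝ, ℍ[ℝ]) ω
        fun z : ℍ[ℝ] × ℍ[ℝ] => z.fst * z.snd := by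
      rw [contMDiff_iff]
      exact ⟨continuous_mul, fun x y => contDiff_mul.contDiffOn⟩
    suffices h₁ : ContMDiff _ _ _ (Prod.map c c) from
      h₂.comp h₁
    apply ContMDiff.prodMap <;> exact contMDiff_coe_sphere
  contMDiff_inv := by
    have h : ∀ x : SU2, ((x⁻¹ : SU2) : ℍ[ℝ]) = star (x : ℍ[ℝ]) := fun x ↦ by
      have hx : Quaternion.normSq (x : ℍ[ℝ]) = 1 := by
        rw [Quaternion.normSq_eq_norm_mul_self, norm_eq_of_mem_sphere, mul_one]
      change ((x : ℍ[ℝ]))⁻¹ = _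
      rw [Quaternion.inv_def, hx, inv_one, one_smul]
    have h₁ : ContMDiff (𝓡 3) 𝓘(ℝ, ℍ[ℝ]) ω (fun x : SU2 ↦ star (x : ℍ[ℝ])) :=
      (LinearMap.toContinuousLinearMap (IsLinearMap.mk' (fun q : ℍ[ℝ] ↦ star q)
        ⟨star_add, fun c q ↦ by ext <;> simp⟩)).contDiff.contMDiff.comp contMDiff_coe_sphere
    have h₂ : ∀ x : SU2, star (x : ℍ[ℝ]) ∈ Metric.sphere (0 : ℍ[ℝ]) 1 := fun x ↦ by
      rw [← h]; exact (x⁻¹).2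
    exact (h₁.codRestrict_sphere h₂).congr fun x ↦ Subtype.ext (h x)

/-- The matrix `[[x + yi, z + wi], [-z + wi, x - yi]]` of the quaternion `x + yi + zj + wk`. -/
def toMatrix (q : ℍ[ℝ]) : Matrix (Fin 2) (Fin 2) ℂ :=
  !![⟨q.re, q.imI⟩, ⟨q.imJ, q.imK⟩; ⟨-q.imJ, q.imK⟩, ⟨q.re, -q.imI⟩]

/-- The inverse of `toMatrix` on `SU(2)`: the quaternion read off the first row. -/
def ofMatrix (A : Matrix (Fin 2) (Fin 2) ℂ) : ℍ[ℝ] :=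
  ⟨(A 0 0).re, (A 0 0).im, (A 0 1).re, (A 0 1).im⟩

/-- Unit quaternions are the same as special unitary `2 × 2` matrices, as a topological group. -/
def su2Equiv : SU2 ≃ₜ* Matrix.specialUnitaryGroup (Fin 2) ℂ where
  toFun q := ⟨toMatrix q, by
    have hq : Quaternion.normSq (q : ℍ[ℝ]) = 1 := by
      rw [Quaternion.normSq_eq_norm_mul_self, norm_eq_of_mem_sphere, mul_one]
    rw [Quaternion.normSq_def'] at hq
    rw [Matrix.mem_specialUnitaryGroup_iff, Matrix.mem_unitaryGroup_iff]
    constructor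
    · ext i j
      fin_cases i <;> fin_cases j <;>
        simp [toMatrix, Matrix.mul_apply, Fin.sum_univ_two, Complex.ext_iff,
          Matrix.star_apply] <;> (try constructor) <;> linarith
    · simp [toMatrix, Matrix.det_fin_two, Complex.ext_iff]
      constructor <;> linarith⟩
  invFun A := ⟨ofMatrix A.1, by
    have h := congrFun (congrFun (Matrix.mem_unitaryGroup_iff.1
      (Matrix.mem_specialUnitaryGroup_iff.1 A.2).1) 0) 0
    simp [Matrix.mul_apply, Fin.sum_univ_two, Matrix.star_apply, Complex.ext_iff] at h
    have h' : ‖ofMatrix A.1‖ * ‖ofMatrix A.1‖ = 1 := by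
      rw [← Quaternion.normSq_eq_norm_mul_self, Quaternion.normSq_def']
      simp only [ofMatrix]
      linarith [h.1]
    rw [mem_sphere_zero_iff_norm]
    nlinarith [norm_nonneg (ofMatrix A.1)]⟩
  left_inv q := by
    apply Subtype.ext
    apply Quaternion.ext <;> simp [toMatrix, ofMatrix]
  right_inv A := by
    have hu := Matrix.mem_unitaryGroup_iff.1 (Matrix.mem_specialUnitaryGroup_iff.1 A.2).1
    have hd := (Matrix.mem_specialUnitaryGroup_iff.1 A.2).2
    have hs : star A.1 = A.1.adjugate := by
      have h1 : A.1 * A.1.adjugate = 1 := by rw [Matrix.mul_adjugate, hd, one_smul]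
      have h2 : A.1.adjugate * A.1 = 1 := by rw [Matrix.adjugate_mul, hd, one_smul]
      calc star A.1 = (A.1.adjugate * A.1) * star A.1 := by rw [h2, one_mul]
        _ = A.1.adjugate := by rw [mul_assoc, hu, mul_one]
    have h00 := congrFun (congrFun hs 0) 0
    have h01 := congrFun (congrFun hs 1) 0
    simp [Matrix.adjugate_fin_two, Matrix.star_apply, Complex.ext_iff] at h00 h01
    apply Subtype.ext
    ext i j
    fin_cases i <;> fin_cases j <;> simp [toMatrix, ofMatrix, Complex.ext_iff]
    · constructor <;> linarith [h01.1, h01.2]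
    · constructor <;> linarith [h00.1, h00.2]
  map_mul' p q := by
    apply Subtype.ext
    ext i j
    fin_cases i <;> fin_cases j <;>
      simp [toMatrix, Complex.ext_iff] <;>
      constructor <;> ring
  continuous_toFun := by
    have hc : ∀ f k : ℍ[ℝ] → ℝ, Continuous f → Continuous k →
        Continuous fun q : SU2 ↦ (⟨f q, k q⟩ : ℂ) := fun f k hf hk ↦
      Complex.equivRealProdCLM.symm.continuous.comp
        ((hf.comp continuous_subtype_val).prodMk (hk.comp continuous_subtype_val))
    refine Continuous.subtype_mk (continuous_matrix fun i j ↦ ?_) _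
    have h1 := Quaternion.continuous_re
    have h2 := Quaternion.continuous_imI
    have h3 := Quaternion.continuous_imJ
    have h4 := Quaternion.continuous_imK
    fin_cases i <;> fin_cases j
    · exact hc _ _ h1 h2
    · exact hc _ _ h3 h4
    · exact hc _ _ h3.neg h4
    · exact hc _ _ h1 h2.neg
  continuous_invFun := by
    refine Continuous.subtype_mk ?_ _
    have hA : ∀ i j, Continuous fun A : Matrix.specialUnitaryGroup (Fin 2) ℂ ↦ A.1 i j :=
      fun i j ↦ continuous_subtype_val.matrix_elem i j
    refine Quaternion.linearIsometryEquivTuple.symm.continuous.comp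
      (g := Quaternion.linearIsometryEquivTuple.symm)
      (f := fun A : Matrix.specialUnitaryGroup (Fin 2) ℂ ↦
        !₂[(A.1 0 0).re, (A.1 0 0).im, (A.1 0 1).re, (A.1 0 1).im]) ?_
    refine (PiLp.continuous_toLp 2 _).comp (continuous_pi fun k ↦ ?_)
    fin_cases k
    · exact Complex.continuous_re.comp (hA 0 0)
    · exact Complex.continuous_im.comp (hA 0 0)
    · exact Complex.continuous_re.comp (hA 0 1)
    · exact Complex.continuous_im.comp (hA 0 1)

/-- The model with corners of `SU(2) × SU(2)`. -/
abbrev I₆ := (𝓡 3).prod (𝓡 3)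

/-- The Lie group `SU(2) × SU(2)`. -/
abbrev G : Type := SU2 × SU2

/-- The two projections of `SU(2) × SU(2)`. -/
def factor (i : Fin 2) (x : G) : SU2 := ![x.1, x.2] i

/-- The left-invariant Maurer-Cartan form `q⁻¹ dq` of the `i`-th factor, where `q⁻¹` is the
conjugate of the unit quaternion `q`. Its values are imaginary quaternions. -/
def maurerCartan (i : Fin 2) (x : G) (u : TangentSpace I₆ x) : ℍ[ℝ] :=
  star (factor i x : ℍ[ℝ]) * mvfderiv I₆ (fun y ↦ (factor i y : ℍ[ℝ])) x u

/-- The left-invariant form `α_i`. The forms `α_i, e_i^-, e_i^+` are `-2` times the `i, j, k`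
components of `q⁻¹ dq`. From `d(q⁻¹ dq) = - q⁻¹ dq ∧ q⁻¹ dq` one gets the Maurer-Cartan equations
`dα_i = e_i^- ∧ e_i^+`, `de_i^+ = α_i ∧ e_i^-` and `de_i^- = - α_i ∧ e_i^+`. -/
def alpha (i : Fin 2) (x : G) (u : TangentSpace I₆ x) : ℝ := -2 * (maurerCartan i x u).imI

/-- The left-invariant form `e_i^-`. -/
def eMinus (i : Fin 2) (x : G) (u : TangentSpace I₆ x) : ℝ := -2 * (maurerCartan i x u).imJ

/-- The left-invariant form `e_i^+`. -/
def ePlus (i : Fin 2) (x : G) (u : TangentSpace I₆ x) : ℝ := -2 * (maurerCartan i x u).imK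

/-- `J` is the left-invariant complex structure with `J α₁ = a α₁ + b α₂`, `J α₂ = c α₁ - a α₂`,
`J e_i^+ = e_i^-` and `J e_i^- = - e_i^+`, where `c = -(a² + 1) / b` and `J` acts on 1-forms by
`(J ξ)(u) = ξ (J u)`. (With the convention `(J ξ)(u) = - ξ (J u)` the formulas would define `-J`,
which has the same Hermitian metrics, the same Bismut connections and the same CYT metrics.) -/
structure IsStructure (a b : ℝ) (J : EndField I₆ G) : Prop where
  alpha₁ : ∀ x u, alpha 0 x (J x u) = a * alpha 0 x u + b * alpha 1 x u
  alpha₂ : ∀ x u, alpha 1 x (J x u) = -(a ^ 2 + 1) / b * alpha 0 x u - a * alpha 1 x u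
  ePlus : ∀ i x u, ePlus i x (J x u) = eMinus i x u
  eMinus : ∀ i x u, eMinus i x (J x u) = - CYT.ePlus i x u

theorem mvfderiv_factor (i : Fin 2) (x : G) (u : TangentSpace I₆ x) :
    mvfderiv I₆ (fun y ↦ (factor i y : ℍ[ℝ])) x u =
      mvfderiv (𝓡 3) ((↑) : SU2 → ℍ[ℝ]) (factor i x) (![u.1, u.2] i) := by
  have hc : ∀ q : SU2, MDifferentiableAt (𝓡 3) 𝓘(ℝ, ℍ[ℝ]) ((↑) : SU2 → ℍ[ℝ]) q := fun q ↦
    (contMDiff_coe_sphere (m := 1)).mdifferentiableAt one_ne_zero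
  fin_cases i
  · have := mfderiv_comp (I := I₆) (I' := 𝓡 3) (I'' := 𝓘(ℝ, ℍ[ℝ])) x (hc x.1)
      (mdifferentiableAt_fst (I := 𝓡 3) (I' := 𝓡 3))
    rw [mfderiv_fst] at this
    exact congrArg (fun L ↦ L u) this
  · have := mfderiv_comp (I := I₆) (I' := 𝓡 3) (I'' := 𝓘(ℝ, ℍ[ℝ])) x (hc x.2)
      (mdifferentiableAt_snd (I := 𝓡 3) (I' := 𝓡 3))
    rw [mfderiv_snd] at this
    exact congrArg (fun L ↦ L u) this

theorem maurerCartan_re (i : Fin 2) (x : G) (u : TangentSpace I₆ x) :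
    (maurerCartan i x u).re = 0 := by
  have h : mvfderiv (𝓡 3) ((↑) : SU2 → ℍ[ℝ]) (factor i x) (![u.1, u.2] i) ∈
      (ℝ ∙ ((factor i x : SU2) : ℍ[ℝ]))ᗮ := by
    rw [← range_mvfderiv_subtypeVal (n := 3)]
    exact ⟨_, rfl⟩
  rw [maurerCartan, mvfderiv_factor]
  rw [Submodule.mem_orthogonal_singleton_iff_inner_right, Quaternion.inner_def] at h
  simp at h ⊢
  linarith

/-- The six forms separate tangent vectors. -/
theorem eq_of_forms_eq {x : G} {u v : TangentSpace I₆ x} (h₀ : ∀ i, alpha i x u = alpha i x v)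
    (h₁ : ∀ i, eMinus i x u = eMinus i x v) (h₂ : ∀ i, ePlus i x u = ePlus i x v) : u = v := by
  have h : ∀ i, (![u.1, u.2] i : EuclideanSpace ℝ (Fin 3)) = ![v.1, v.2] i := fun i ↦ by
    have hm : maurerCartan i x u = maurerCartan i x v := by
      have a₀ := h₀ i
      have a₁ := h₁ i
      have a₂ := h₂ i
      simp only [alpha, eMinus, ePlus] at a₀ a₁ a₂
      apply Quaternion.ext
      · rw [maurerCartan_re, maurerCartan_re]
      all_goals linarith
    have hne : star (factor i x : ℍ[ℝ]) ≠ 0 := by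
      rw [Ne, star_eq_zero]
      exact ne_zero_of_mem_unit_sphere _
    have := mul_left_cancel₀ hne hm
    rw [mvfderiv_factor, mvfderiv_factor] at this
    exact injective_mvfderiv_subtypeVal_sphere (n := 3) (factor i x) this
  exact Prod.ext (h 0) (h 1)

/-- The coframe `(α₁, e₁^-, e₁^+, α₂, e₂^-, e₂^+)` at a point. -/
def coframe (x : G) : TangentSpace I₆ x →ₗ[ℝ] (Fin 2 → Fin 3 → ℝ) where
  toFun u i := ![alpha i x u, eMinus i x u, ePlus i x u]
  map_add' u v := by
    ext i j
    fin_cases j <;> simp [alpha, eMinus, ePlus, maurerCartan, mul_add]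
  map_smul' c u := by
    ext i j
    fin_cases j <;> simp [alpha, eMinus, ePlus, maurerCartan] <;> ring

/-- For all `a` and `b` there is exactly one `J` given by the formulas of `IsStructure`. -/
theorem existsUnique_isStructure (a b : ℝ) : ∃! J : EndField I₆ G, IsStructure a b J := by
  have hinj : ∀ x, Function.Injective (coframe x) := fun x u v h ↦
    eq_of_forms_eq (fun i ↦ congrFun (congrFun h i) 0) (fun i ↦ congrFun (congrFun h i) 1)
      (fun i ↦ congrFun (congrFun h i) 2)
  have hsurj : ∀ x, Function.Surjective (coframe x) := fun x ↦ by
    have : FiniteDimensional ℝ (TangentSpace I₆ x) :=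
      inferInstanceAs (FiniteDimensional ℝ (EuclideanSpace ℝ (Fin 3) × EuclideanSpace ℝ (Fin 3)))
    have hr : Module.finrank ℝ (TangentSpace I₆ x) = Module.finrank ℝ (Fin 2 → Fin 3 → ℝ) := by
      change Module.finrank ℝ (EuclideanSpace ℝ (Fin 3) × EuclideanSpace ℝ (Fin 3)) = _
      rw [Module.finrank_pi_fintype]
      simp
    exact (LinearMap.injective_iff_surjective_of_finrank_eq_finrank hr).1 (hinj x)
  let C : (x : G) → TangentSpace I₆ x ≃ₗ[ℝ] (Fin 2 → Fin 3 → ℝ) := fun x ↦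
    LinearEquiv.ofBijective (coframe x) ⟨hinj x, hsurj x⟩
  let A : (Fin 2 → Fin 3 → ℝ) →ₗ[ℝ] (Fin 2 → Fin 3 → ℝ) :=
    { toFun := fun f ↦ ![![a * f 0 0 + b * f 1 0, - f 0 2, f 0 1],
        ![-(a ^ 2 + 1) / b * f 0 0 - a * f 1 0, - f 1 2, f 1 1]]
      map_add' := fun f k ↦ by
        ext i j
        fin_cases i <;> fin_cases j <;> simp <;> ring
      map_smul' := fun r f ↦ by
        ext i j
        fin_cases i <;> fin_cases j <;> simp <;> ring }
  let J₀ : (x : G) → TangentSpace I₆ x →ₗ[ℝ] TangentSpace I₆ x := fun x ↦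
    (C x).symm.toLinearMap ∘ₗ A ∘ₗ (C x).toLinearMap
  let J : EndField I₆ G := fun x ↦
    ⟨J₀ x, by
      have : FiniteDimensional ℝ (TangentSpace I₆ x) :=
        inferInstanceAs (FiniteDimensional ℝ (EuclideanSpace ℝ (Fin 3) × EuclideanSpace ℝ (Fin 3)))
      have : T2Space (TangentSpace I₆ x) :=
        inferInstanceAs (T2Space (EuclideanSpace ℝ (Fin 3) × EuclideanSpace ℝ (Fin 3)))
      exact LinearMap.continuous_of_finiteDimensional (J₀ x)⟩
  have hJ : ∀ x u, coframe x (J x u) = A (coframe x u) := fun x u ↦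
    (C x).apply_symm_apply (A (C x u))
  refine ⟨J, ⟨fun x u ↦ congrFun (congrFun (hJ x u) 0) 0, fun x u ↦
    congrFun (congrFun (hJ x u) 1) 0, fun i x u ↦ ?_, fun i x u ↦ ?_⟩, fun K hK ↦ ?_⟩
  · have := congrFun (congrFun (hJ x u) i) 2
    fin_cases i <;> exact this
  · have := congrFun (congrFun (hJ x u) i) 1
    fin_cases i <;> exact this
  · funext x
    ext1 u
    apply hinj x
    rw [hJ]
    ext i j
    fin_cases i <;> fin_cases j
    · exact hK.alpha₁ x u
    · exact hK.eMinus 0 x u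
    · exact hK.ePlus 0 x u
    · exact hK.alpha₂ x u
    · exact hK.eMinus 1 x u
    · exact hK.ePlus 1 x u

end CYT

end

noncomputable section

namespace CYT

section Calculus

open VectorField

variable {E : Type*} [NormedAddCommGroup E] [NormedSpace ℝ E]
  {H : Type*} [TopologicalSpace H] {I : ModelWithCorners ℝ E H}
  {M : Type*} [TopologicalSpace M] [ChartedSpace H M]
  {F F' F'' : Type*} [NormedAddCommGroup F] [NormedSpace ℝ F] [NormedAddCommGroup F']
  [NormedSpace ℝ F'] [NormedAddCommGroup F''] [NormedSpace ℝ F'']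

theorem mvfderiv_bilinear (B : F →L[ℝ] F' →L[ℝ] F'') {f : M → F} {k : M → F'} {x : M}
    (hf : MDifferentiableAt I 𝓘(ℝ, F) f x) (hk : MDifferentiableAt I 𝓘(ℝ, F') k x)
    (u : TangentSpace I x) :
    mvfderiv I (fun y ↦ B (f y) (k y)) x u =
      B (mvfderiv I f x u) (k x) + B (f x) (mvfderiv I k x u) := by
  have h : HasMFDerivAt I 𝓘(ℝ, F'') (fun y ↦ B (f y) (k y)) x
      (B.precompR E (f x) (mfderiv I 𝓘(ℝ, F') k x) +
        B.precompL E (mfderiv I 𝓘(ℝ, F) f x) (k x)) := by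
    refine ⟨(B.continuous.continuousAt.comp hf.continuousAt).clm_apply hk.continuousAt, ?_⟩
    have := B.hasFDerivWithinAt_of_bilinear hf.hasMFDerivAt.2 hk.hasMFDerivAt.2
    simpa [writtenInExtChartAt] using! this
  have h' := congrArg (fun L : TangentSpace I x →L[ℝ] F'' ↦ L u) h.mfderiv
  exact h'.trans (add_comm _ _)

theorem contMDiffAt_bilinear (B : F →L[ℝ] F' →L[ℝ] F'') {n : WithTop ℕ∞} {f : M → F} {k : M → F'}
    {x : M} (hf : ContMDiffAt I 𝓘(ℝ, F) n f x) (hk : ContMDiffAt I 𝓘(ℝ, F') n k x) :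
    ContMDiffAt I 𝓘(ℝ, F'') n (fun y ↦ B (f y) (k y)) x :=
  (B.contMDiff.contMDiffAt.comp x hf).clm_apply hk

theorem mdifferentiableAt_bilinear (B : F →L[ℝ] F' →L[ℝ] F'') {f : M → F} {k : M → F'} {x : M}
    (hf : MDifferentiableAt I 𝓘(ℝ, F) f x) (hk : MDifferentiableAt I 𝓘(ℝ, F') k x) :
    MDifferentiableAt I 𝓘(ℝ, F'') (fun y ↦ B (f y) (k y)) x :=
  ((B.contMDiff (n := 1)).mdifferentiableAt one_ne_zero |>.comp x hf).clm_apply hk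

theorem mdifferentiableAt_clm_comp (L : F →L[ℝ] F') {f : M → F} {x : M}
    (hf : MDifferentiableAt I 𝓘(ℝ, F) f x) :
    MDifferentiableAt I 𝓘(ℝ, F') (fun y ↦ L (f y)) x :=
  (L.contMDiff (n := 1)).mdifferentiableAt one_ne_zero |>.comp x hf

theorem mvfderiv_clm_comp (L : F →L[ℝ] F') {f : M → F} {x : M}
    (hf : MDifferentiableAt I 𝓘(ℝ, F) f x) (u : TangentSpace I x) :
    mvfderiv I (fun y ↦ L (f y)) x u = L (mvfderiv I f x u) := by
  have h : HasMFDerivAt I 𝓘(ℝ, F') (fun y ↦ L (f y)) x (L ∘L (mfderiv I 𝓘(ℝ, F) f x)) :=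
    L.hasMFDerivAt.comp x hf.hasMFDerivAt
  exact congrArg (fun L : TangentSpace I x →L[ℝ] F' ↦ L u) h.mfderiv

variable [IsManifold I ∞ M]

theorem contMDiffAt_mvfderiv_apply {f : M → F} (hf : ContMDiff I 𝓘(ℝ, F) ∞ f)
    {Y : (x : M) → TangentSpace I x} {x : M}
    (hY : ContMDiffAt I I.tangent ∞ (fun y ↦ (⟨y, Y y⟩ : TangentBundle I M)) x) :
    ContMDiffAt I 𝓘(ℝ, F) ∞ (fun y ↦ mvfderiv I f y (Y y)) x := by
  have h₁ : ContMDiff I.tangent 𝓘(ℝ, F).tangent ∞ (tangentMap I 𝓘(ℝ, F) f) :=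
    hf.contMDiff_tangentMap (m := ∞) (by simp)
  exact ((contMDiff_snd_tangentBundle_modelSpace F 𝓘(ℝ, F)).comp h₁).contMDiffAt.comp x hY

theorem mdifferentiableAt_mvfderiv_apply {f : M → F} (hf : ContMDiff I 𝓘(ℝ, F) ∞ f)
    {Y : (x : M) → TangentSpace I x} {x : M}
    (hY : MDifferentiableAt I I.tangent (fun y ↦ (⟨y, Y y⟩ : TangentBundle I M)) x) :
    MDifferentiableAt I 𝓘(ℝ, F) (fun y ↦ mvfderiv I f y (Y y)) x := by
  have h₁ : ContMDiff I.tangent 𝓘(ℝ, F).tangent ∞ (tangentMap I 𝓘(ℝ, F) f) :=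
    hf.contMDiff_tangentMap (m := ∞) (by simp)
  exact (((contMDiff_snd_tangentBundle_modelSpace F 𝓘(ℝ, F)).comp h₁).mdifferentiableAt
    (by simp)).comp x hY

theorem SmoothField.mlieBracket [FiniteDimensional ℝ E] {X Y : VField I M}
    (hX : SmoothField X) (hY : SmoothField Y) : SmoothField (mlieBracket I X Y) := by
  intro x
  have : IsManifold I ((⊤ : ℕ∞) + 1) M := inferInstanceAs (IsManifold I ∞ M)
  have : IsManifold I (minSmoothness ℝ 2) M := by
    rw [minSmoothness_of_isRCLikeNormedField]; infer_instance
  exact ContMDiffAt.mlieBracket_vectorField (m := ⊤) (n := ⊤) (hX x) (hY x) (by simp)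

theorem SmoothField.mdifferentiableAt {X : VField I M} (hX : SmoothField X) (x : M) :
    MDifferentiableAt I I.tangent (fun y ↦ (⟨y, X y⟩ : TangentBundle I M)) x :=
  (hX x).mdifferentiableAt (by simp)

theorem SmoothField.smul {X : VField I M} (hX : SmoothField X) {f : M → ℝ}
    (hf : ContMDiff I 𝓘(ℝ, ℝ) ∞ f) : SmoothField (f • X) :=
  ContMDiff.smul_section hf hX

/-- The Lie bracket of vector fields acts on functions as the commutator. The Jacobi identity for
`X`, `Y` and `f • Z` reduces this to the existence of a field `Z` that does not vanish at `x`. -/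
theorem mvfderiv_mlieBracket_real [FiniteDimensional ℝ E] {X Y Z : VField I M}
    (hX : SmoothField X) (hY : SmoothField Y) (hZ : SmoothField Z) {f : M → ℝ}
    (hf : ContMDiff I 𝓘(ℝ, ℝ) ∞ f) {x : M} (hx : Z x ≠ 0) :
    mvfderiv I f x (mlieBracket I X Y x) =
      mvfderiv I (fun y ↦ mvfderiv I f y (Y y)) x (X x) -
        mvfderiv I (fun y ↦ mvfderiv I f y (X y)) x (Y x) := by
  have : IsManifold I (minSmoothness ℝ 3) M := by
    rw [minSmoothness_of_isRCLikeNormedField]; infer_instance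
  have hd : ∀ {W : VField I M}, SmoothField W →
      ContMDiff I 𝓘(ℝ, ℝ) ∞ (fun y ↦ mvfderiv I f y (W y)) := fun hW y ↦
    contMDiffAt_mvfderiv_apply hf (hW y)
  have hm : ∀ {k : M → ℝ}, ContMDiff I 𝓘(ℝ, ℝ) ∞ k → ∀ y, MDifferentiableAt I 𝓘(ℝ, ℝ) k y :=
    fun hk y ↦ (hk y).mdifferentiableAt (by simp)
  have hbr : ∀ {W : VField I M}, mlieBracket I W (f • Z) =
      (fun y ↦ mvfderiv I f y (W y)) • Z + f • mlieBracket I W Z := by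
    intro W
    funext y
    exact mlieBracket_smul_right (hm hf y) (hZ.mdifferentiableAt y)
  have hbr₂ : ∀ {W W' : VField I M}, SmoothField W → SmoothField W' →
      mlieBracket I W (mlieBracket I W' (f • Z)) x =
        mvfderiv I (fun y ↦ mvfderiv I f y (W' y)) x (W x) • Z x +
          mvfderiv I f x (W' x) • mlieBracket I W Z x +
          (mvfderiv I f x (W x) • mlieBracket I W' Z x +
            f x • mlieBracket I W (mlieBracket I W' Z) x) := by
    intro W W' hW hW'
    rw [hbr, mlieBracket_add_right ((hZ.smul (hd hW')).mdifferentiableAt x)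
      (((hW'.mlieBracket hZ).smul hf).mdifferentiableAt x),
      mlieBracket_smul_right (hm (hd hW') x) (hZ.mdifferentiableAt x),
      mlieBracket_smul_right (hm hf x) ((hW'.mlieBracket hZ).mdifferentiableAt x)]
  have h2 : ∀ {W : VField I M}, SmoothField W →
      ContMDiffAt I I.tangent (minSmoothness ℝ 2) (fun y ↦ (⟨y, W y⟩ : TangentBundle I M)) x :=
    fun hW ↦ (hW x).of_le (by
      rw [minSmoothness_of_isRCLikeNormedField]; exact ENat.LEInfty.out)
  have J₁ := leibniz_identity_mlieBracket_apply (h2 hX) (h2 hY) (h2 (hZ.smul hf))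
  have J₂ := leibniz_identity_mlieBracket_apply (h2 hX) (h2 hY) (h2 hZ)
  rw [hbr₂ hX hY, hbr₂ hY hX, hbr, J₂] at J₁
  simp only [Pi.add_apply, Pi.smul_apply', smul_add] at J₁
  have : (mvfderiv I f x (mlieBracket I X Y x) -
      (mvfderiv I (fun y ↦ mvfderiv I f y (Y y)) x (X x) -
        mvfderiv I (fun y ↦ mvfderiv I f y (X y)) x (Y x))) • Z x = 0 := by
    rw [sub_smul, sub_smul, sub_eq_zero, eq_comm, sub_eq_iff_eq_add, ← sub_eq_zero,
      ← sub_eq_zero.2 J₁]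
    abel
  exact sub_eq_zero.1 ((smul_eq_zero.1 this).resolve_right hx)

theorem mvfderiv_mlieBracket [FiniteDimensional ℝ E] [FiniteDimensional ℝ F] {X Y Z : VField I M}
    (hX : SmoothField X) (hY : SmoothField Y) (hZ : SmoothField Z) {f : M → F}
    (hf : ContMDiff I 𝓘(ℝ, F) ∞ f) {x : M} (hx : Z x ≠ 0) :
    mvfderiv I f x (mlieBracket I X Y x) =
      mvfderiv I (fun y ↦ mvfderiv I f y (Y y)) x (X x) -
        mvfderiv I (fun y ↦ mvfderiv I f y (X y)) x (Y x) := by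
  have hm : ∀ {k : M → F}, ContMDiff I 𝓘(ℝ, F) ∞ k → ∀ y, MDifferentiableAt I 𝓘(ℝ, F) k y :=
    fun hk y ↦ (hk y).mdifferentiableAt (by simp)
  refine (Module.finBasis ℝ F).ext_elem fun i ↦ ?_
  let L : F →L[ℝ] ℝ := LinearMap.toContinuousLinearMap ((Module.finBasis ℝ F).coord i)
  change L _ = L _
  have h := mvfderiv_mlieBracket_real hX hY hZ (f := fun y ↦ L (f y)) (L.contMDiff.comp hf) hx
  have h1 : ∀ y (u : TangentSpace I y), mvfderiv I (fun y ↦ L (f y)) y u = L (mvfderiv I f y u) :=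
    fun y u ↦ mvfderiv_clm_comp L (hm hf y) u
  have h2 : ∀ W : VField I M, (fun y ↦ mvfderiv I (fun y ↦ L (f y)) y (W y)) =
      fun y ↦ L (mvfderiv I f y (W y)) := fun W ↦ funext fun y ↦ h1 y _
  rw [h1, h2, h2] at h
  rw [h, map_sub, ← mvfderiv_clm_comp L, ← mvfderiv_clm_comp L]
  · exact (contMDiffAt_mvfderiv_apply hf (hX x)).mdifferentiableAt (by simp)
  · exact (contMDiffAt_mvfderiv_apply hf (hY x)).mdifferentiableAt (by simp)

end Calculus

section Framing

open VectorField

/-- The Lie algebra of `SU(2) × SU(2)`, in coordinates with respect to the coframe. -/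
abbrev LieAlg : Type := Fin 2 → Fin 3 → ℝ

/-- The bracket of left-invariant vector fields in terms of the coframe. -/
def lieBr (v w : LieAlg) : LieAlg := fun i ↦
  ![v i 2 * w i 1 - v i 1 * w i 2, v i 0 * w i 2 - v i 2 * w i 0, v i 1 * w i 0 - v i 0 * w i 1]

theorem coframe_injective (x : G) : Function.Injective (coframe x) := fun _ _ h ↦
  eq_of_forms_eq (fun i ↦ congrFun (congrFun h i) 0) (fun i ↦ congrFun (congrFun h i) 1)
    (fun i ↦ congrFun (congrFun h i) 2)

instance finiteDimensional_tangentSpace (x : G) : FiniteDimensional ℝ (TangentSpace I₆ x) :=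
  inferInstanceAs (FiniteDimensional ℝ (EuclideanSpace ℝ (Fin 3) × EuclideanSpace ℝ (Fin 3)))

instance t2Space_tangentSpace (x : G) : T2Space (TangentSpace I₆ x) :=
  inferInstanceAs (T2Space (EuclideanSpace ℝ (Fin 3) × EuclideanSpace ℝ (Fin 3)))

theorem coframe_surjective (x : G) : Function.Surjective (coframe x) := by
  have hr : Module.finrank ℝ (TangentSpace I₆ x) = Module.finrank ℝ LieAlg := by
    change Module.finrank ℝ (EuclideanSpace ℝ (Fin 3) × EuclideanSpace ℝ (Fin 3)) = _
    rw [Module.finrank_pi_fintype]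
    simp
  exact (LinearMap.injective_iff_surjective_of_finrank_eq_finrank hr).1 (coframe_injective x)

/-- The trivialization of the tangent bundle by the coframe. -/
def coframeEquiv (x : G) : TangentSpace I₆ x ≃L[ℝ] LieAlg :=
  (LinearEquiv.ofBijective (coframe x)
    ⟨coframe_injective x, coframe_surjective x⟩).toContinuousLinearEquiv

/-- The left-invariant vector field with the given components. -/
def invField (v : LieAlg) : VField I₆ G := fun x ↦ (coframeEquiv x).symm v

@[simp]
theorem coframeEquiv_invField (v : LieAlg) (x : G) : coframeEquiv x (invField v x) = v :=
  (coframeEquiv x).apply_symm_apply v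

theorem invField_coframeEquiv (x : G) (u : TangentSpace I₆ x) :
    invField (coframeEquiv x u) x = u :=
  (coframeEquiv x).symm_apply_apply u

theorem coframeEquiv_zero_apply (x : G) (u : TangentSpace I₆ x) (i : Fin 2) :
    coframeEquiv x u i 0 = -2 * (maurerCartan i x u).imI := rfl

theorem coframeEquiv_one_apply (x : G) (u : TangentSpace I₆ x) (i : Fin 2) :
    coframeEquiv x u i 1 = -2 * (maurerCartan i x u).imJ := rfl

theorem coframeEquiv_two_apply (x : G) (u : TangentSpace I₆ x) (i : Fin 2) :
    coframeEquiv x u i 2 = -2 * (maurerCartan i x u).imK := rfl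

theorem contMDiff_factor (i : Fin 2) :
    ContMDiff I₆ 𝓘(ℝ, ℍ[ℝ]) ∞ (fun y : G ↦ (factor i y : ℍ[ℝ])) := by
  fin_cases i
  · exact contMDiff_coe_sphere.comp contMDiff_fst
  · exact contMDiff_coe_sphere.comp contMDiff_snd

theorem mdifferentiableAt_factor (i : Fin 2) (x : G) :
    MDifferentiableAt I₆ 𝓘(ℝ, ℍ[ℝ]) (fun y : G ↦ (factor i y : ℍ[ℝ])) x :=
  (contMDiff_factor i x).mdifferentiableAt (by simp)

theorem self_mul_star_factor (i : Fin 2) (x : G) :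
    (factor i x : ℍ[ℝ]) * star (factor i x : ℍ[ℝ]) = 1 := by
  rw [Quaternion.self_mul_star, Quaternion.normSq_eq_norm_mul_self, norm_eq_of_mem_sphere]
  simp

/-- The linear map of the Lie algebra coordinates to the components of the Maurer-Cartan form. -/
def toQuaternion (i : Fin 2) (v : LieAlg) : ℍ[ℝ] := ⟨0, -(v i 0) / 2, -(v i 1) / 2, -(v i 2) / 2⟩

@[simp] theorem toQuaternion_re (i : Fin 2) (v : LieAlg) : (toQuaternion i v).re = 0 := rfl

@[simp] theorem toQuaternion_imI (i : Fin 2) (v : LieAlg) :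
    (toQuaternion i v).imI = -(v i 0) / 2 := rfl

@[simp] theorem toQuaternion_imJ (i : Fin 2) (v : LieAlg) :
    (toQuaternion i v).imJ = -(v i 1) / 2 := rfl

@[simp] theorem toQuaternion_imK (i : Fin 2) (v : LieAlg) :
    (toQuaternion i v).imK = -(v i 2) / 2 := rfl

theorem maurerCartan_eq (i : Fin 2) (x : G) (u : TangentSpace I₆ x) :
    maurerCartan i x u = toQuaternion i (coframeEquiv x u) := by
  have h0 := coframeEquiv_zero_apply x u i
  have h1 := coframeEquiv_one_apply x u i
  have h2 := coframeEquiv_two_apply x u i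
  apply Quaternion.ext
  · exact maurerCartan_re i x u
  · simp only [toQuaternion]; linarith
  · simp only [toQuaternion]; linarith
  · simp only [toQuaternion]; linarith

theorem mvfderiv_factor_eq (i : Fin 2) (x : G) (u : TangentSpace I₆ x) :
    mvfderiv I₆ (fun y : G ↦ (factor i y : ℍ[ℝ])) x u =
      (factor i x : ℍ[ℝ]) * toQuaternion i (coframeEquiv x u) := by
  rw [← maurerCartan_eq, maurerCartan, ← mul_assoc, self_mul_star_factor, one_mul]

theorem coframeEquiv_ext {x : G} {u : TangentSpace I₆ x} {v : LieAlg}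
    (h : ∀ i, mvfderiv I₆ (fun y : G ↦ (factor i y : ℍ[ℝ])) x u =
      (factor i x : ℍ[ℝ]) * toQuaternion i v) : coframeEquiv x u = v := by
  have hq : ∀ i, toQuaternion i (coframeEquiv x u) = toQuaternion i v := fun i ↦ by
    have := (mvfderiv_factor_eq i x u).symm.trans (h i)
    exact mul_left_cancel₀ (left_ne_zero_of_mul_eq_one (self_mul_star_factor i x)) this
  funext i j
  have h0 := congrArg QuaternionAlgebra.imI (hq i)
  have h1 := congrArg QuaternionAlgebra.imJ (hq i)
  have h2 := congrArg QuaternionAlgebra.imK (hq i)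
  simp only [toQuaternion] at h0 h1 h2
  fin_cases j <;> simp <;> linarith

/-! ### Regularity of fields in terms of the coframe -/

/-- The bilinear map `(p, q) ↦ p̄ q` on the quaternions. -/
def starMul : ℍ[ℝ] →L[ℝ] ℍ[ℝ] →L[ℝ] ℍ[ℝ] :=
  (ContinuousLinearMap.mul ℝ ℍ[ℝ]).comp
    (LinearMap.toContinuousLinearMap (IsLinearMap.mk' (fun q : ℍ[ℝ] ↦ star q)
        ⟨star_add, fun c q ↦ by ext <;> simp⟩))

/-- The coframe of the `i`-th factor in terms of the Maurer-Cartan form. -/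
def ofQuaternion (i : Fin 2) : ℍ[ℝ] →L[ℝ] LieAlg :=
  LinearMap.toContinuousLinearMap (IsLinearMap.mk'
    (fun q : ℍ[ℝ] ↦ (fun i' ↦ if i' = i then ![-2 * q.imI, -2 * q.imJ, -2 * q.imK] else 0))
    ⟨fun p q ↦ by ext i' j; by_cases h : i' = i <;> fin_cases j <;> simp [h, mul_add],
      fun c q ↦ by ext i' j; by_cases h : i' = i <;> fin_cases j <;> simp [h] <;> ring⟩)

theorem coframeEquiv_eq_ofQuaternion (x : G) (u : TangentSpace I₆ x) :
    coframeEquiv x u =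
      ofQuaternion 0 (starMul (factor 0 x) (mvfderiv I₆ (fun y : G ↦ (factor 0 y : ℍ[ℝ])) x u)) +
      ofQuaternion 1 (starMul (factor 1 x)
        (mvfderiv I₆ (fun y : G ↦ (factor 1 y : ℍ[ℝ])) x u)) := by
  ext i j
  fin_cases i
  · refine Eq.trans ?_ (add_zero _).symm
    fin_cases j <;> rfl
  · refine Eq.trans ?_ (zero_add _).symm
    fin_cases j <;> rfl

theorem contMDiffAt_coframeEquiv {Y : VField I₆ G} {x : G}
    (hY : ContMDiffAt I₆ I₆.tangent ∞ (fun y ↦ (⟨y, Y y⟩ : TangentBundle I₆ G)) x) :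
    ContMDiffAt I₆ 𝓘(ℝ, LieAlg) ∞ (fun y ↦ coframeEquiv y (Y y)) x := by
  have h : ∀ i, ContMDiffAt I₆ 𝓘(ℝ, LieAlg) ∞ (fun y ↦ ofQuaternion i (starMul (factor i y)
      (mvfderiv I₆ (fun y : G ↦ (factor i y : ℍ[ℝ])) y (Y y)))) x := fun i ↦
    (ofQuaternion i).contMDiff.contMDiffAt.comp x (contMDiffAt_bilinear starMul
      (contMDiff_factor i x) (contMDiffAt_mvfderiv_apply (contMDiff_factor i) hY))
  simp only [coframeEquiv_eq_ofQuaternion]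
  exact (h 0).add (h 1)

theorem SmoothField.contMDiff_coframeEquiv {Y : VField I₆ G} (hY : SmoothField Y) :
    ContMDiff I₆ 𝓘(ℝ, LieAlg) ∞ (fun y ↦ coframeEquiv y (Y y)) := fun x ↦
  contMDiffAt_coframeEquiv (hY x)

theorem mdifferentiableAt_coframeEquiv {Y : VField I₆ G} {x : G}
    (hY : MDifferentiableAt I₆ I₆.tangent (fun y ↦ (⟨y, Y y⟩ : TangentBundle I₆ G)) x) :
    MDifferentiableAt I₆ 𝓘(ℝ, LieAlg) (fun y ↦ coframeEquiv y (Y y)) x := by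
  have h : ∀ i, MDifferentiableAt I₆ 𝓘(ℝ, LieAlg) (fun y ↦ ofQuaternion i (starMul (factor i y)
      (mvfderiv I₆ (fun y : G ↦ (factor i y : ℍ[ℝ])) y (Y y)))) x := fun i ↦
    mdifferentiableAt_clm_comp (ofQuaternion i) (mdifferentiableAt_bilinear starMul
      (mdifferentiableAt_factor i x) (mdifferentiableAt_mvfderiv_apply (contMDiff_factor i) hY))
  simp only [coframeEquiv_eq_ofQuaternion]
  exact (h 0).add (h 1)

/-- Left translations preserve the coframe. -/
theorem coframeEquiv_mul (h x : G) (u : TangentSpace I₆ x) :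
    coframeEquiv (h * x) (mfderiv I₆ I₆ (fun y ↦ h * y) x u) = coframeEquiv x u := by
  refine coframeEquiv_ext fun i ↦ ?_
  have hL : MDifferentiableAt I₆ I₆ (fun y : G ↦ h * y) x :=
    (contMDiff_mul_left (I := I₆) (n := ω) (a := h)).mdifferentiableAt (by simp)
  have hf : ∀ y : G, (factor i (h * y) : ℍ[ℝ]) = (factor i h : ℍ[ℝ]) * factor i y := by
    intro y
    fin_cases i <;> rfl
  have h1 : mvfderiv I₆ (fun y : G ↦ (factor i y : ℍ[ℝ])) (h * x)
      (mfderiv I₆ I₆ (fun y ↦ h * y) x u) =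
      mvfderiv I₆ (fun y : G ↦ (factor i (h * y) : ℍ[ℝ])) x u :=
    (mfderiv_comp_apply x (mdifferentiableAt_factor i (h * x)) hL u).symm
  rw [h1, hf]
  simp only [hf]
  have h2 := mvfderiv_clm_comp (ContinuousLinearMap.mul ℝ ℍ[ℝ] (factor i h))
    (mdifferentiableAt_factor i x) u
  simp only [ContinuousLinearMap.mul_apply'] at h2
  rw [h2, mvfderiv_factor_eq, mul_assoc]

theorem invField_eq_mulInvariantVectorField (v : LieAlg) :
    invField v = mulInvariantVectorField (I := I₆) (G := G) (invField v 1) := by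
  funext x
  apply (coframeEquiv x).injective
  have := coframeEquiv_mul x 1 (invField v 1)
  rw [coframeEquiv_invField] at this ⊢
  have h : ∀ y : G, y = x → ∀ w : TangentSpace I₆ y,
    coframeEquiv y w = coframeEquiv x w := by rintro y rfl w; rfl
  exact this.symm.trans (h _ (mul_one x) _)

theorem smoothField_invField (v : LieAlg) : SmoothField (invField v) := by
  rw [invField_eq_mulInvariantVectorField]
  set w : TangentSpace I₆ (1 : G) := invField v 1
  let f₀ : G → TangentBundle I₆ G := fun x ↦ ⟨x, 0⟩
  have s₀ : ContMDiff I₆ I₆.tangent ∞ f₀ := Bundle.contMDiff_zeroSection _ _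
  let f₁ : G → TangentBundle I₆ G := fun _ ↦ ⟨1, w⟩
  have s₁ : ContMDiff I₆ I₆.tangent ∞ f₁ := contMDiff_const
  have s₂ : ContMDiff (I₆.tangent.prod I₆.tangent) (I₆.prod I₆).tangent ∞
      (equivTangentBundleProd I₆ G I₆ G).symm := contMDiff_equivTangentBundleProd_symm
  have hm : ContMDiff (I₆.prod I₆) I₆ ω (fun p : G × G ↦ p.1 * p.2) := contMDiff_mul I₆ ω
  have s₃ : ContMDiff (I₆.prod I₆).tangent I₆.tangent ∞
      (tangentMap (I₆.prod I₆) I₆ (fun p : G × G ↦ p.1 * p.2)) :=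
    hm.contMDiff_tangentMap le_top
  have S := (s₃.comp s₂).comp (s₀.prodMk s₁)
  unfold SmoothField
  convert! S with x
  · simp [f₀, f₁]
  · simp only [Function.comp_apply, tangentMap, f₀, f₁]
    rw [mfderiv_prod_eq_add_apply (hm.mdifferentiableAt (by simp))]
    refine (Eq.trans (congrArg₂ (· + ·) ?_ rfl) (zero_add _)).symm
    exact map_zero (mfderiv I₆ I₆ (fun z : G ↦ z * (1 : G)) x)

theorem mvfderiv_factor_invField (i : Fin 2) (v : LieAlg) (x : G) :
    mvfderiv I₆ (fun y : G ↦ (factor i y : ℍ[ℝ])) x (invField v x) =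
      (factor i x : ℍ[ℝ]) * toQuaternion i v := by
  rw [mvfderiv_factor_eq, coframeEquiv_invField]

theorem invField_ne_zero {v : LieAlg} (hv : v ≠ 0) (x : G) : invField v x ≠ 0 := by
  intro h
  have := coframeEquiv_invField v x
  rw [h, map_zero] at this
  exact hv this.symm

theorem mlieBracket_apply_function {F : Type*} [NormedAddCommGroup F] [NormedSpace ℝ F]
    [FiniteDimensional ℝ F] {X Y : VField I₆ G} (hX : SmoothField X)
    (hY : SmoothField Y) {f : G → F} (hf : ContMDiff I₆ 𝓘(ℝ, F) ∞ f) (x : G) :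
    mvfderiv I₆ f x (mlieBracket I₆ X Y x) =
      mvfderiv I₆ (fun y ↦ mvfderiv I₆ f y (Y y)) x (X x) -
        mvfderiv I₆ (fun y ↦ mvfderiv I₆ f y (X y)) x (Y x) :=
  mvfderiv_mlieBracket hX hY (smoothField_invField 1) hf (invField_ne_zero one_ne_zero x)

theorem mlieBracket_invField (v w : LieAlg) :
    mlieBracket I₆ (invField v) (invField w) = invField (lieBr v w) := by
  funext x
  apply (coframeEquiv x).injective
  rw [coframeEquiv_invField]
  refine coframeEquiv_ext fun i ↦ ?_
  rw [mlieBracket_apply_function (smoothField_invField v) (smoothField_invField w)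
    (contMDiff_factor i)]
  simp only [mvfderiv_factor_invField]
  have h : ∀ v w : LieAlg, mvfderiv I₆ (fun y : G ↦ (factor i y : ℍ[ℝ]) * toQuaternion i w) x
      (invField v x) = (factor i x : ℍ[ℝ]) * (toQuaternion i v * toQuaternion i w) := fun v w ↦ by
    have h2 := mvfderiv_clm_comp ((ContinuousLinearMap.mul ℝ ℍ[ℝ]).flip (toQuaternion i w))
      (mdifferentiableAt_factor i x) (invField v x)
    simp only [ContinuousLinearMap.flip_apply, ContinuousLinearMap.mul_apply'] at h2
    rw [h2, mvfderiv_factor_invField, mul_assoc]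
  rw [h, h, ← mul_sub]
  congr 1
  apply Quaternion.ext <;> simp [lieBr] <;> ring

end Framing

section LinearAlgebra

variable {V : Type*} [AddCommGroup V] [Module ℝ V]

theorem exists_basis_orthonormal [FiniteDimensional ℝ V] {B : V →ₗ[ℝ] V →ₗ[ℝ] ℝ}
    (symm : ∀ v w, B v w = B w v) (pos : ∀ v, v ≠ 0 → 0 < B v v) {n : ℕ}
    (hn : Module.finrank ℝ V = n) :
    ∃ e : Module.Basis (Fin n) ℝ V, ∀ i j, B (e i) (e j) = if i = j then 1 else 0 := by
  subst hn
  obtain ⟨v, hv⟩ := LinearMap.BilinForm.exists_orthogonal_basis (B := B) ⟨symm⟩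
  have hp : ∀ i, 0 < B (v i) (v i) := fun i ↦ pos _ (v.ne_zero i)
  have hu : ∀ i, IsUnit (Real.sqrt (B (v i) (v i)))⁻¹ := fun i ↦
    (inv_ne_zero (Real.sqrt_pos.2 (hp i)).ne').isUnit
  refine ⟨v.isUnitSMul hu, fun i j ↦ ?_⟩
  simp only [Module.Basis.isUnitSMul_apply, map_smul, LinearMap.smul_apply, smul_eq_mul]
  split_ifs with h
  · subst h
    have := Real.mul_self_sqrt (hp i).le
    have h0 := (Real.sqrt_pos.2 (hp i)).ne'
    field_simp
    rw [sq, this]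
  · rw [show B (v i) (v j) = 0 from hv h]
    simp

variable {B : V →ₗ[ℝ] V →ₗ[ℝ] ℝ}

section Frame

variable {n : ℕ} {e : Module.Basis (Fin n) ℝ V}

theorem repr_eq_of_orthonormal
    (he : ∀ i j, B (e i) (e j) = if i = j then 1 else 0) (v : V) (i : Fin n) :
    e.repr v i = B v (e i) := by
  nth_rw 2 [← e.sum_repr v]
  rw [map_sum, LinearMap.sum_apply]
  simp [he]

theorem sum_smul_of_orthonormal
    (he : ∀ i j, B (e i) (e j) = if i = j then 1 else 0) (v : V) : ∑ i, B v (e i) • e i = v := by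
  conv_rhs => rw [← e.sum_repr v]
  simp [repr_eq_of_orthonormal he]

theorem trace_eq_sum_of_orthonormal
    (he : ∀ i j, B (e i) (e j) = if i = j then 1 else 0) (T : V →ₗ[ℝ] V) :
    LinearMap.trace ℝ V T = ∑ i, B (T (e i)) (e i) := by
  rw [LinearMap.trace_eq_matrix_trace ℝ e, Matrix.trace]
  simp [LinearMap.toMatrix_apply, repr_eq_of_orthonormal he]

/-- Replacing an orthonormal frame by its image under a skew endomorphism. -/
theorem sum_skew_swap (he : ∀ i j, B (e i) (e j) = if i = j then 1 else 0)
    (symm : ∀ v w, B v w = B w v) {J : V →ₗ[ℝ] V}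
    (hJ : ∀ v w, B (J v) w = - B v (J w)) (β : V →ₗ[ℝ] V →ₗ[ℝ] ℝ) :
    ∑ k, β (J (e k)) (e k) = - ∑ k, β (e k) (J (e k)) := by
  have h1 : ∀ k, β (J (e k)) (e k) = ∑ l, B (J (e k)) (e l) * β (e l) (e k) := fun k ↦ by
    conv_lhs => rw [← sum_smul_of_orthonormal he (J (e k))]
    simp
  have h2 : ∀ k, β (e k) (J (e k)) = ∑ l, B (J (e k)) (e l) * β (e k) (e l) := fun k ↦ by
    conv_lhs => rw [← sum_smul_of_orthonormal he (J (e k))]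
    simp
  simp only [h1, h2]
  rw [Finset.sum_comm, ← Finset.sum_neg_distrib]
  refine Finset.sum_congr rfl fun k _ ↦ ?_
  rw [← Finset.sum_neg_distrib]
  refine Finset.sum_congr rfl fun l _ ↦ ?_
  rw [hJ (e l), symm]
  ring

end Frame

/-- The algebraic properties of the Bismut connection of a left-invariant Hermitian structure on a
Lie group: `Γ` gives the covariant derivatives of left-invariant fields, `br` is the bracket. -/
structure IsAlgBismut (B : V →ₗ[ℝ] V →ₗ[ℝ] ℝ) (J : V →ₗ[ℝ] V) (br Γ : V →ₗ[ℝ] V →ₗ[ℝ] V) :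
    Prop where
  metric : ∀ u v w, B (Γ u v) w + B v (Γ u w) = 0
  complex : ∀ u v, Γ u (J v) = J (Γ u v)
  skew : ∀ u v w, B (Γ u v - Γ v u - br u v) w = - B (Γ u w - Γ w u - br u w) v

section Algebraic

variable {J : V →ₗ[ℝ] V} {br Γ Γ' : V →ₗ[ℝ] V →ₗ[ℝ] V}

theorem IsAlgBismut.unique (symm : ∀ v w, B v w = B w v) (pos : ∀ v, v ≠ 0 → 0 < B v v)
    (hJ : ∀ v w, B (J v) w = - B v (J w)) (hJJ : ∀ v, J (J v) = - v) (h : IsAlgBismut B J br Γ)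
    (h' : IsAlgBismut B J br Γ') : Γ = Γ' := by
  let d : V → V → V → ℝ := fun u v w ↦ B (Γ u v - Γ' u v) w
  have hd : ∀ u v w, d u v w = - d u w v := fun u v w ↦ by
    have h1 := h.metric u v w
    have h2 := h'.metric u v w
    simp only [d, map_sub, LinearMap.sub_apply]
    rw [symm (Γ u w), symm (Γ' u w)]
    linarith
  have hc : ∀ u v w, d v u w = d w v u := fun u v w ↦ by
    have h1 := h.skew u v w
    have h2 := h'.skew u v w
    have h3 := hd u v w
    have h4 := hd w u v
    simp only [d, map_sub, LinearMap.sub_apply] at h1 h2 h3 h4 ⊢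
    linarith
  have hdJ : ∀ u v w, d u (J v) w = - d u v (J w) := fun u v w ↦ by
    simp only [d, h.complex, h'.complex, ← map_sub]
    exact hJ _ _
  have hdJ' : ∀ u v w, d (J u) v w = d u v (J w) := fun u v w ↦ by
    rw [hc v (J u) w, hdJ w u v, hc u w (J v), hc w (J v) u, hdJ, neg_neg]
  have h0 : ∀ u v w, d u v (J w) = 0 := fun u v w ↦ by
    have a1 := hdJ' u v w
    have a2 := hdJ' u w v
    have a3 := hd (J u) v w
    have a4 := hd u w (J v)
    have a5 := hdJ u v w
    linarith
  ext u v
  by_contra hne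
  have := pos _ (sub_ne_zero.2 hne)
  have h1 := h0 u v (-J (Γ u v - Γ' u v))
  simp only [map_neg, hJJ, neg_neg] at h1
  exact this.ne' h1

/-- The trace of `J ∘ Γ u` for a unimodular bracket. -/
theorem IsAlgBismut.sum_eq (symm : ∀ v w, B v w = B w v)
    (hJ : ∀ v w, B (J v) w = - B v (J w)) {n : ℕ} {e : Module.Basis (Fin n) ℝ V}
    (he : ∀ i j, B (e i) (e j) = if i = j then 1 else 0) (h : IsAlgBismut B J br Γ)
    (hbr : ∀ u v, br u v = - br v u)
    (htr : ∀ u, LinearMap.trace ℝ V (br u) = 0) (u : V) :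
    ∑ k, B (Γ u (e k)) (J (e k)) =
      - LinearMap.trace ℝ V (J ∘ₗ br u) - ∑ k, B (br (e k) (J (e k))) u := by
  have hs' : ∀ u, ∑ k, B (Γ (e k) u) (e k) = 0 := fun u ↦ by
    have h1 : ∀ k, B (Γ (e k) u) (e k) = - B (br u (e k)) (e k) := fun k ↦ by
      have a1 := h.skew u (e k) (e k)
      have a2 := h.metric u (e k) (e k)
      rw [symm (e k)] at a2
      simp only [map_sub, LinearMap.sub_apply] at a1
      linarith
    simp only [h1]
    rw [Finset.sum_neg_distrib, ← trace_eq_sum_of_orthonormal he, htr, neg_zero]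
  have hs : ∀ u, ∑ k, B (Γ (e k) u) (J (e k)) = 0 := fun u ↦ by
    have h1 : ∀ k, B (Γ (e k) u) (J (e k)) = - B (Γ (e k) (J u)) (e k) := fun k ↦ by
      rw [h.complex, hJ, neg_neg]
    simp only [h1]
    rw [Finset.sum_neg_distrib, hs', neg_zero]
  have hs₂ : ∑ k, B (Γ (J (e k)) u) (e k) = 0 := by
    have := sum_skew_swap he symm hJ (LinearMap.mk₂ ℝ (fun v w ↦ B (Γ v u) w)
      (by intros; simp) (by intros; simp) (by intros; simp) (by intros; simp))
    simp only [LinearMap.mk₂_apply] at this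
    rw [this, hs, neg_zero]
  have ht : LinearMap.trace ℝ V (J ∘ₗ br u) = - ∑ k, B (br u (e k)) (J (e k)) := by
    rw [trace_eq_sum_of_orthonormal he, ← Finset.sum_neg_distrib]
    exact Finset.sum_congr rfl fun k _ ↦ hJ _ _
  have hk : ∀ k, B (Γ u (e k)) (J (e k)) = B (br u (e k)) (J (e k)) - B (br (e k) (J (e k))) u +
      (B (Γ (J (e k)) u) (e k)) := fun k ↦ by
    have a1 := h.skew (e k) u (J (e k))
    have a2 := h.metric (e k) (J (e k)) u
    have a3 := h.metric (J (e k)) (e k) u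
    have a4 := hbr (e k) u
    rw [a4] at a1
    rw [symm (J (e k))] at a2
    rw [symm (e k)] at a3
    simp only [map_sub, LinearMap.sub_apply, map_neg, LinearMap.neg_apply] at a1
    linarith
  simp only [hk]
  rw [Finset.sum_add_distrib, Finset.sum_sub_distrib, hs₂, ht]
  ring

end Algebraic

end LinearAlgebra

section Necessity

open VectorField

/-- The bracket as a bilinear map. -/
def lieBrL : LieAlg →ₗ[ℝ] LieAlg →ₗ[ℝ] LieAlg :=
  LinearMap.mk₂ ℝ lieBr
    (fun u v w ↦ by ext i j; fin_cases j <;> simp [lieBr] <;> ring)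
    (fun c u v ↦ by ext i j; fin_cases j <;> simp [lieBr] <;> ring)
    (fun u v w ↦ by ext i j; fin_cases j <;> simp [lieBr] <;> ring)
    (fun c u v ↦ by ext i j; fin_cases j <;> simp [lieBr] <;> ring)

theorem lieBrL_apply (u v : LieAlg) : lieBrL u v = lieBr u v := rfl

/-- The complex structure on the Lie algebra. -/
def stdJ (a b : ℝ) : LieAlg →ₗ[ℝ] LieAlg where
  toFun f := ![![a * f 0 0 + b * f 1 0, - f 0 2, f 0 1],
        ![-(a ^ 2 + 1) / b * f 0 0 - a * f 1 0, - f 1 2, f 1 1]]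
  map_add' := fun f k ↦ by
    ext i j
    fin_cases i <;> fin_cases j <;> simp <;> ring
  map_smul' := fun r f ↦ by
    ext i j
    fin_cases i <;> fin_cases j <;> simp <;> ring

theorem stdJ_apply (a b : ℝ) (f : LieAlg) :
    stdJ a b f = ![![a * f 0 0 + b * f 1 0, - f 0 2, f 0 1],
        ![-(a ^ 2 + 1) / b * f 0 0 - a * f 1 0, - f 1 2, f 1 1]] := rfl

theorem stdJ_stdJ (a : ℝ) {b : ℝ} (hb : b ≠ 0) (v : LieAlg) :
    stdJ a b (stdJ a b v) = - v := by
  ext i j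
  fin_cases i <;> fin_cases j <;> simp [stdJ_apply] <;> field_simp <;> ring

theorem IsStructure.coframeEquiv_apply {a b : ℝ} {J : EndField I₆ G} (hJ : IsStructure a b J)
    (x : G) (u : TangentSpace I₆ x) : coframeEquiv x (J x u) = stdJ a b (coframeEquiv x u) := by
  ext i j
  fin_cases i <;> fin_cases j
  · exact hJ.alpha₁ x u
  · exact hJ.eMinus 0 x u
  · exact hJ.ePlus 0 x u
  · exact hJ.alpha₂ x u
  · exact hJ.eMinus 1 x u
  · exact hJ.ePlus 1 x u

theorem IsStructure.apply_invField {a b : ℝ} {J : EndField I₆ G} (hJ : IsStructure a b J) (x : G)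
    (v : LieAlg) : J x (invField v x) = invField (stdJ a b v) x := by
  apply (coframeEquiv x).injective
  rw [hJ.coframeEquiv_apply, coframeEquiv_invField, coframeEquiv_invField]

theorem trace_lieAlg (T : LieAlg →ₗ[ℝ] LieAlg) :
    LinearMap.trace ℝ LieAlg T =
      ∑ i, ∑ j, T (Pi.single i (Pi.single j 1)) i j := by
  rw [LinearMap.trace_eq_matrix_trace ℝ (Pi.basis fun _ : Fin 2 ↦ Pi.basisFun ℝ (Fin 3)),
    Matrix.trace, Fintype.sum_sigma]
  simp [LinearMap.toMatrix_apply, Pi.basis_apply]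

theorem trace_lieBrL (u : LieAlg) : LinearMap.trace ℝ LieAlg (lieBrL u) = 0 := by
  rw [trace_lieAlg]
  simp [Fin.sum_univ_three, lieBrL_apply, lieBr]

theorem trace_stdJ_lieBrL (a b : ℝ) (u : LieAlg) :
    LinearMap.trace ℝ LieAlg (stdJ a b ∘ₗ lieBrL u) = 2 * (u 0 0 + u 1 0) := by
  rw [trace_lieAlg]
  simp [Fin.sum_univ_two, Fin.sum_univ_three, lieBrL_apply, lieBr, stdJ_apply]
  ring

theorem lieBr_swap (u v : LieAlg) : lieBr u v = - lieBr v u := by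
  ext i j
  fin_cases j <;> simp [lieBr] <;> ring

/-- The Lie algebra is perfect. -/
theorem eq_zero_of_lieBr (φ : LieAlg →ₗ[ℝ] ℝ) (h : ∀ u v, φ (lieBr u v) = 0) : φ = 0 := by
  refine LinearMap.ext fun v ↦ ?_
  have hv : v = lieBr (fun i ↦ ![0, 0, 1]) (fun i ↦ ![0, v i 0, 0]) +
      lieBr (fun i ↦ ![1, 0, 0]) (fun i ↦ ![0, 0, v i 1]) +
      lieBr (fun i ↦ ![0, 1, 0]) (fun i ↦ ![v i 2, 0, 0]) := by
    ext i j
    fin_cases j <;> simp [lieBr]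
  rw [hv, map_add, map_add, h, h, h]
  simp

/-- The inequalities for an invariant Hermitian inner product that satisfies the CYT equation. -/
theorem inequalities_of_sum_eq {a b : ℝ} (hb : b ≠ 0) {B : LieAlg →ₗ[ℝ] LieAlg →ₗ[ℝ] ℝ}
    (symm : ∀ v w, B v w = B w v) (hJ : ∀ v w, B (stdJ a b v) w = - B v (stdJ a b w))
    {n : ℕ} {e : Module.Basis (Fin n) ℝ LieAlg}
    (he : ∀ i j, B (e i) (e j) = if i = j then 1 else 0)
    (h : ∀ u, ∑ k, B (lieBr (e k) (stdJ a b (e k))) u = - (2 * (u 0 0 + u 1 0))) :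
    0 < b * (b - a) ∧ 0 < a ^ 2 + 1 - a * b := by
  let φ : Fin 2 → Fin 3 → LieAlg →ₗ[ℝ] ℝ := fun i j ↦ LinearMap.proj j ∘ₗ LinearMap.proj i
  have hne : ∀ i j, ∃ k, e k i j ≠ 0 := by
    intro i j
    by_contra! hc
    have : φ i j = 0 := e.ext hc
    have := LinearMap.congr_fun this (Pi.single i (Pi.single j 1))
    simp [φ] at this
  have hZ : ∀ i, 0 < ∑ l, e l i 0 * (e l 0 0 + e l 1 0) := by
    intro i
    have h1 : ∑ l, e l i 0 * (2 * (e l 0 0 + e l 1 0)) =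
        ∑ k, ((e k i 1) ^ 2 + (e k i 2) ^ 2) := by
      set Z := ∑ k, lieBr (e k) (stdJ a b (e k)) with hZdef
      have h2 : ∀ l, B Z (e l) = - (2 * (e l 0 0 + e l 1 0)) := fun l ↦ by
        rw [← h, hZdef, map_sum, LinearMap.sum_apply]
      have h3 := congrArg (φ i 0) (sum_smul_of_orthonormal he Z)
      simp only [map_sum, map_smul, h2] at h3
      rw [hZdef, map_sum] at h3
      simp only [φ, LinearMap.comp_apply, LinearMap.proj_apply, smul_eq_mul] at h3
      have h4 : ∀ k, lieBr (e k) (stdJ a b (e k)) i 0 = - ((e k i 1) ^ 2 + (e k i 2) ^ 2) := by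
        intro k
        fin_cases i <;> simp [lieBr, stdJ_apply] <;> ring
      simp only [h4, neg_mul, Finset.sum_neg_distrib, neg_inj] at h3
      rw [← h3]
      exact Finset.sum_congr rfl fun l _ ↦ by ring
    have h2 : 0 < ∑ k, ((e k i 1) ^ 2 + (e k i 2) ^ 2) := by
      obtain ⟨k, hk⟩ := hne i 1
      exact Finset.sum_pos' (fun k _ ↦ by positivity) ⟨k, Finset.mem_univ _, by positivity⟩
    rw [← h1] at h2
    have h3 : ∑ l, e l i 0 * (2 * (e l 0 0 + e l 1 0)) =
        2 * ∑ l, e l i 0 * (e l 0 0 + e l 1 0) := by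
      rw [Finset.mul_sum]
      exact Finset.sum_congr rfl fun l _ ↦ by ring
    linarith
  set p := ∑ l, e l 0 0 * e l 0 0 with hp
  set q := ∑ l, e l 0 0 * e l 1 0 with hq
  set r := ∑ l, e l 1 0 * e l 1 0 with hr
  have hppos : 0 < p := by
    obtain ⟨k, hk⟩ := hne 0 0
    exact Finset.sum_pos' (fun k _ ↦ mul_self_nonneg _)
      ⟨k, Finset.mem_univ _, mul_self_pos.2 hk⟩
  have hswap := sum_skew_swap he symm hJ
  have e1 : a * p + b * q = 0 := by
    have := hswap ((φ 0 0).smulRight (φ 0 0))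
    simp [φ, stdJ_apply] at this
    have h1 : a * p + b * q = ∑ k, (a * e k 0 0 + b * e k 1 0) * e k 0 0 := by
      rw [hp, hq, Finset.mul_sum, Finset.mul_sum, ← Finset.sum_add_distrib]
      exact Finset.sum_congr rfl fun l _ ↦ by ring
    have h2 : a * p + b * q = ∑ k, e k 0 0 * (a * e k 0 0 + b * e k 1 0) := by
      rw [h1]
      exact Finset.sum_congr rfl fun l _ ↦ by ring
    linarith
  have e2 : a ^ 2 * p + 2 * a * b * q + b ^ 2 * r = p := by
    have := hswap ((φ 0 0).smulRight (φ 0 0 ∘ₗ stdJ a b))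
    simp only [LinearMap.smulRight_apply, LinearMap.smul_apply, LinearMap.comp_apply,
      stdJ_stdJ a hb] at this
    simp [φ, stdJ_apply] at this
    rw [← hp] at this
    refine Eq.trans ?_ this
    rw [hp, hq, hr, Finset.mul_sum, Finset.mul_sum, Finset.mul_sum,
      ← Finset.sum_add_distrib, ← Finset.sum_add_distrib]
    exact Finset.sum_congr rfl fun l _ ↦ by ring
  have z0 : 0 < p + q := by
    have := hZ 0
    simpa only [mul_add, Finset.sum_add_distrib, ← hp, ← hq] using this
  have z1 : 0 < q + r := by
    have := hZ 1
    have hq' : ∑ l, e l 1 0 * e l 0 0 = q := Finset.sum_congr rfl fun l _ ↦ mul_comm _ _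
    simpa only [mul_add, Finset.sum_add_distrib, hq', ← hr] using this
  have hb2 : 0 < b ^ 2 := by positivity
  constructor
  · have : p * (b * (b - a)) = b ^ 2 * (p + q) := by linear_combination (-b) * e1
    exact pos_of_mul_pos_right (this ▸ mul_pos hb2 z0) hppos.le
  · have : p * (a ^ 2 + 1 - a * b) = b ^ 2 * (q + r) := by
      linear_combination (-b + 2 * a) * e1 - e2
    exact pos_of_mul_pos_right (this ▸ mul_pos hb2 z1) hppos.le

theorem invField_add (v w : LieAlg) : invField (v + w) = invField v + invField w :=
  funext fun x ↦ map_add (coframeEquiv x).symm v w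

theorem invField_smul (c : ℝ) (v : LieAlg) : invField (c • v) = c • invField v :=
  funext fun x ↦ map_smul (coframeEquiv x).symm c v

theorem invField_sub (v w : LieAlg) : invField (v - w) = invField v - invField w :=
  funext fun x ↦ map_sub (coframeEquiv x).symm v w

/-- The inner product on the Lie algebra of a Riemannian metric. -/
def innerAtOne (g : SmoothMetric I₆ G) : LieAlg →ₗ[ℝ] LieAlg →ₗ[ℝ] ℝ :=
  LinearMap.mk₂ ℝ (fun v w ↦ g.inner 1 (invField v 1) (invField w 1))
    (fun u v w ↦ by simp [invField_add]) (fun c u v ↦ by simp [invField_smul])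
    (fun u v w ↦ by simp [invField_add]) (fun c u v ↦ by simp [invField_smul])

theorem innerAtOne_symm (g : SmoothMetric I₆ G) (v w : LieAlg) :
    innerAtOne g v w = innerAtOne g w v := g.symm 1 _ _

theorem innerAtOne_pos (g : SmoothMetric I₆ G) (v : LieAlg) (hv : v ≠ 0) :
    0 < innerAtOne g v v := g.pos 1 _ (invField_ne_zero hv 1)

theorem IsLeftInvariant.inner_invField {g : SmoothMetric I₆ G} (hg : IsLeftInvariant g) (x : G)
    (v w : LieAlg) : g.inner x (invField v x) (invField w x) = innerAtOne g v w := by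
  have h : ∀ y : G, y = x → ∀ u u' : TangentSpace I₆ y, g.inner y u u' = g.inner x u u' := by
    rintro y rfl u u'
    rfl
  rw [invField_eq_mulInvariantVectorField v, invField_eq_mulInvariantVectorField w]
  exact (h _ (mul_one x) _ _).symm.trans (hg x 1 (invField v 1) (invField w 1))

theorem IsLeftInvariant.inner_eq {g : SmoothMetric I₆ G} (hg : IsLeftInvariant g) (x : G)
    (u v : TangentSpace I₆ x) :
    g.inner x u v = innerAtOne g (coframeEquiv x u) (coframeEquiv x v) := by
  rw [← hg.inner_invField x, invField_coframeEquiv, invField_coframeEquiv]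

/-- The covariant derivatives of left-invariant fields at a point. -/
def christoffel (D : Connection I₆ G) (x : G) : LieAlg →ₗ[ℝ] LieAlg →ₗ[ℝ] LieAlg :=
  have hm : ∀ v, MDifferentiableAt I₆ I₆.tangent
      (fun y ↦ (⟨y, invField v y⟩ : TangentBundle I₆ G)) x := fun v ↦
    (smoothField_invField v).mdifferentiableAt x
  LinearMap.mk₂ ℝ (fun v w ↦ coframeEquiv x (D (invField w) x (invField v x)))
    (fun u v w ↦ by simp [invField_add]) (fun c u v ↦ by simp [invField_smul])
    (fun u v w ↦ by
      rw [invField_add v, D.isCovariantDerivativeOn.add (s := Set.univ) (hm v) (hm w)]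
      simp)
    (fun c u v ↦ by
      rw [invField_smul c v, D.isCovariantDerivativeOn.smul_const (s := Set.univ) c (hm v)]
      simp)

theorem christoffel_apply (D : Connection I₆ G) (x : G) (v w : LieAlg) :
    christoffel D x v w = coframeEquiv x (D (invField w) x (invField v x)) := rfl

theorem covariantDerivative_invField (D : Connection I₆ G) (x : G) (v w : LieAlg) :
    D (invField w) x (invField v x) = invField (christoffel D x v w) x := by
  rw [christoffel_apply, invField_coframeEquiv]

theorem coframeEquiv_torsion_invField (D : Connection I₆ G) (x : G) (v w : LieAlg) :
    coframeEquiv x (D.torsion x (invField v x) (invField w x)) =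
      christoffel D x v w - christoffel D x w v - lieBrL v w := by
  rw [D.torsion_apply ((smoothField_invField v).mdifferentiableAt x)
    ((smoothField_invField w).mdifferentiableAt x), mlieBracket_invField, map_sub, map_sub,
    coframeEquiv_invField]
  rfl

theorem IsBismut.isAlgBismut {a b : ℝ} {J : EndField I₆ G} (hJ : IsStructure a b J)
    {g : SmoothMetric I₆ G} (hg : IsLeftInvariant g) {D : Connection I₆ G} (hD : IsBismut J g D)
    (x : G) : IsAlgBismut (innerAtOne g) (stdJ a b) lieBrL (christoffel D x) where
  metric u v w := by
    have h := hD.metric (invField v) (invField w) (smoothField_invField v)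
      (smoothField_invField w) x (invField u x)
    have hc : (fun y ↦ g.inner y (invField v y) (invField w y)) = fun _ ↦ innerAtOne g v w :=
      funext fun y ↦ hg.inner_invField y v w
    rw [hc, mvfderiv_const] at h
    simpa only [covariantDerivative_invField, hg.inner_invField] using! h.symm
  complex u v := by
    have h := hD.complex (invField v) (smoothField_invField v) x (invField u x)
    have hc : (fun y ↦ J y (invField v y)) = invField (stdJ a b v) :=
      funext fun y ↦ hJ.apply_invField y v
    rw [hc] at h
    rw [christoffel_apply, h, hJ.coframeEquiv_apply, christoffel_apply]
  skew u v w := by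
    have h := hD.skew x (invField u x) (invField v x) (invField w x)
    simpa only [hg.inner_eq, coframeEquiv_torsion_invField, coframeEquiv_invField] using h

theorem inequalities_of_isCYT {a b : ℝ} (hb : b ≠ 0) {J : EndField I₆ G} (hJ : IsStructure a b J)
    {g : SmoothMetric I₆ G} (hg : IsLeftInvariant g) (h : IsCYT J g) :
    0 < b * (b - a) ∧ 0 < a ^ 2 + 1 - a * b := by
  obtain ⟨hH, D, hD, hR⟩ := h
  have symm := innerAtOne_symm g
  have hB : ∀ v w, innerAtOne g (stdJ a b v) w = - innerAtOne g v (stdJ a b w) := by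
    intro v w
    have := hH 1 (invField v 1) (invField (stdJ a b w) 1)
    rw [hJ.apply_invField, hJ.apply_invField, stdJ_stdJ a hb, hg.inner_invField,
      hg.inner_invField, map_neg] at this
    linarith
  have hfin : Module.finrank ℝ LieAlg =
      Module.finrank ℝ (EuclideanSpace ℝ (Fin 3) × EuclideanSpace ℝ (Fin 3)) := by
    rw [Module.finrank_pi_fintype]
    simp
  obtain ⟨e, he⟩ := exists_basis_orthonormal symm (innerAtOne_pos g) hfin
  set Γ := christoffel D 1 with hΓ
  have hA : IsAlgBismut (innerAtOne g) (stdJ a b) lieBrL Γ := hD.isAlgBismut hJ hg 1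
  have hcov : ∀ v w, (fun y ↦ D (invField w) y (invField v y)) = invField (Γ v w) := by
    intro v w
    funext y
    rw [covariantDerivative_invField, IsAlgBismut.unique symm (innerAtOne_pos g) hB
      (stdJ_stdJ a hb) (hD.isAlgBismut hJ hg y) hA]
  have hcurv : ∀ u v w, curvature D (invField u) (invField v) (invField w) 1 =
      invField (Γ u (Γ v w) - Γ v (Γ u w) - Γ (lieBr u v) w) 1 := by
    intro u v w
    simp only [curvature, hcov, mlieBracket_invField, invField_sub, Pi.sub_apply]
    exact congrArg₂ _ (congrArg₂ _ (congrFun (hcov u _) 1) (congrFun (hcov v _) 1))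
      (congrFun (hcov _ w) 1)
  have hT : ∀ T : LieAlg →ₗ[ℝ] LieAlg, ∑ k, innerAtOne g (T (e k)) (stdJ a b (e k)) =
      - LinearMap.trace ℝ LieAlg (stdJ a b ∘ₗ T) := by
    intro T
    rw [trace_eq_sum_of_orthonormal he, ← Finset.sum_neg_distrib]
    refine Finset.sum_congr rfl fun k _ ↦ ?_
    rw [LinearMap.comp_apply, hB, neg_neg]
  have hcomm : ∀ u v, LinearMap.trace ℝ LieAlg (stdJ a b ∘ₗ (Γ u ∘ₗ Γ v)) =
      LinearMap.trace ℝ LieAlg (stdJ a b ∘ₗ (Γ v ∘ₗ Γ u)) := by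
    intro u v
    have h1 : stdJ a b ∘ₗ (Γ u ∘ₗ Γ v) = Γ u * (stdJ a b ∘ₗ Γ v) := by
      refine LinearMap.ext fun w ↦ ?_
      exact (hA.complex u (Γ v w)).symm
    rw [h1, LinearMap.trace_mul_comm]
    rfl
  let η : LieAlg →ₗ[ℝ] ℝ := ∑ k, (innerAtOne g).flip (stdJ a b (e k)) ∘ₗ Γ.flip (e k)
  have hη_apply : ∀ u, η u = ∑ k, innerAtOne g (Γ u (e k)) (stdJ a b (e k)) := by
    intro u
    simp [η, LinearMap.sum_apply]
  have hη : η = 0 := by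
    refine eq_zero_of_lieBr η fun u v ↦ ?_
    have h1 := hR (invField u) (invField v) (smoothField_invField u) (smoothField_invField v) 1
      (fun k ↦ invField (e k)) (fun k ↦ smoothField_invField _)
      (fun i j ↦ by rw [hg.inner_invField]; exact he i j)
    simp only [hcurv, hJ.apply_invField, hg.inner_invField, map_sub, LinearMap.sub_apply,
      Finset.sum_sub_distrib] at h1
    have h2 := hT (Γ u ∘ₗ Γ v)
    have h3 := hT (Γ v ∘ₗ Γ u)
    simp only [LinearMap.comp_apply] at h2 h3
    rw [h2, h3, hcomm u v, sub_self, zero_sub, neg_eq_zero] at h1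
    rw [hη_apply]
    exact h1
  refine inequalities_of_sum_eq hb symm hB he fun u ↦ ?_
  have h1 := hA.sum_eq symm hB he (fun u v ↦ lieBr_swap u v) trace_lieBrL u
  rw [← hη_apply, hη, trace_stdJ_lieBrL] at h1
  simp only [lieBrL_apply, LinearMap.zero_apply] at h1
  linarith

end Necessity

section InvariantMetric

theorem isVonNBounded_of_pos {V : Type*} [NormedAddCommGroup V] [NormedSpace ℝ V]
    [FiniteDimensional ℝ V] {B : V →ₗ[ℝ] V →ₗ[ℝ] ℝ}
    (symm : ∀ v w, B v w = B w v) (pos : ∀ v, v ≠ 0 → 0 < B v v) :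
    Bornology.IsVonNBounded ℝ {v : V | B v v < 1} := by
  obtain ⟨e, he⟩ := exists_basis_orthonormal symm pos rfl
  rw [NormedSpace.isVonNBounded_iff, isBounded_iff_forall_norm_le]
  refine ⟨∑ i, ‖e i‖, fun v hv ↦ ?_⟩
  have h1 : B v v = ∑ i, B v (e i) ^ 2 := by
    nth_rw 2 [← sum_smul_of_orthonormal he v]
    simp [sq]
  have h2 : ∀ i, |B v (e i)| ≤ 1 := fun i ↦ by
    rw [← sq_le_one_iff_abs_le_one]
    refine le_trans ?_ (h1 ▸ le_of_lt hv : ∑ i, B v (e i) ^ 2 ≤ 1)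
    exact Finset.single_le_sum (f := fun i ↦ B v (e i) ^ 2) (fun i _ ↦ sq_nonneg _)
      (Finset.mem_univ i)
  calc ‖v‖ = ‖∑ i, B v (e i) • e i‖ := by rw [sum_smul_of_orthonormal he v]
    _ ≤ ∑ i, ‖B v (e i) • e i‖ := norm_sum_le _ _
    _ ≤ ∑ i, ‖e i‖ := Finset.sum_le_sum fun i _ ↦ by
      rw [norm_smul, Real.norm_eq_abs]
      exact mul_le_of_le_one_left (norm_nonneg _) (h2 i)

variable (B : LieAlg →ₗ[ℝ] LieAlg →ₗ[ℝ] ℝ)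

/-- The left-invariant bilinear form on the tangent spaces defined by a bilinear form on the Lie
algebra. -/
def invForm (x : G) : TangentSpace I₆ x →L[ℝ] TangentSpace I₆ x →L[ℝ] ℝ :=
  (B.compl₁₂ (coframeEquiv x : TangentSpace I₆ x →ₗ[ℝ] LieAlg)
    (coframeEquiv x : TangentSpace I₆ x →ₗ[ℝ] LieAlg)).toContinuousBilinearMap

/-- A family of linear maps on a finite-dimensional space is smooth if it is so pointwise. -/
theorem contMDiffAt_clm_of_apply {E H M F F' : Type*} [NormedAddCommGroup E] [NormedSpace ℝ E]
    [TopologicalSpace H] {I : ModelWithCorners ℝ E H} [TopologicalSpace M] [ChartedSpace H M]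
    [NormedAddCommGroup F] [NormedSpace ℝ F] [FiniteDimensional ℝ F] [NormedAddCommGroup F']
    [NormedSpace ℝ F'] {f : M → F →L[ℝ] F'} {x : M}
    (h : ∀ v, ContMDiffAt I 𝓘(ℝ, F') ∞ (fun y ↦ f y v) x) :
    ContMDiffAt I 𝓘(ℝ, F →L[ℝ] F') ∞ f x := by
  let e := Module.finBasis ℝ F
  let c : Fin (Module.finrank ℝ F) → F →L[ℝ] ℝ := fun i ↦
    LinearMap.toContinuousLinearMap (e.coord i)
  have hf : f = fun y ↦ ∑ i, ContinuousLinearMap.smulRightL ℝ F F' (c i) (f y (e i)) := by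
    funext y
    ext v
    conv_lhs => rw [← e.sum_repr v, map_sum]
    simp [c]
  rw [hf]
  exact contMDiffAt_finsetSum fun i _ ↦
    (ContinuousLinearMap.smulRightL ℝ F F' (c i)).contMDiff.contMDiffAt.comp x (h (e i))

theorem contMDiff_invForm :
    ContMDiff I₆ (I₆.prod 𝓘(ℝ, (EuclideanSpace ℝ (Fin 3) × EuclideanSpace ℝ (Fin 3)) →L[ℝ]
        (EuclideanSpace ℝ (Fin 3) × EuclideanSpace ℝ (Fin 3)) →L[ℝ] ℝ)) ∞
      (fun x : G ↦ Bundle.TotalSpace.mk'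
        ((EuclideanSpace ℝ (Fin 3) × EuclideanSpace ℝ (Fin 3)) →L[ℝ]
        (EuclideanSpace ℝ (Fin 3) × EuclideanSpace ℝ (Fin 3)) →L[ℝ] ℝ)
        (E := fun x ↦ TangentSpace I₆ x →L[ℝ] TangentSpace I₆ x →L[ℝ] ℝ) x (invForm B x)) := by
  intro x
  rw [contMDiffAt_hom_bundle]
  refine ⟨contMDiffAt_id, ?_⟩
  refine contMDiffAt_clm_of_apply fun v ↦ contMDiffAt_clm_of_apply fun w ↦ ?_
  let t := trivializationAt (EuclideanSpace ℝ (Fin 3) × EuclideanSpace ℝ (Fin 3))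
    (TangentSpace I₆ : G → Type _) x
  have hx : x ∈ t.baseSet := FiberBundle.mem_baseSet_trivializationAt' x
  have hs : ∀ v, ContMDiffAt I₆ 𝓘(ℝ, LieAlg) ∞ (fun y ↦ coframeEquiv y (t.symm y v)) x := by
    intro v
    apply contMDiffAt_coframeEquiv
    have h1 : ContMDiffAt I₆ (I₆.prod 𝓘(ℝ, EuclideanSpace ℝ (Fin 3) × EuclideanSpace ℝ (Fin 3))) ∞
        (fun y : G ↦ (y, v)) x := contMDiffAt_id.prodMk contMDiffAt_const
    have h2 := (t.contMDiffOn_symm (IB := I₆) (n := ∞)).contMDiffAt (x := (x, v))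
      (t.open_target.mem_nhds (t.mem_target.2 hx))
    refine (h2.comp x h1).congr_of_eventuallyEq ?_
    filter_upwards [t.open_baseSet.mem_nhds hx] with y hy
    exact t.mk_symm hy v
  refine (contMDiffAt_bilinear B.toContinuousBilinearMap (hs v) (hs w)).congr_of_eventuallyEq ?_
  filter_upwards [t.open_baseSet.mem_nhds hx] with y hy
  rw [inCoordinates_apply_eq₂ hy hy (Set.mem_univ _)]
  simp
  rfl

variable {B}

/-- The left-invariant metric defined by an inner product on the Lie algebra. -/
def invMetric (symm : ∀ v w, B v w = B w v) (pos : ∀ v, v ≠ 0 → 0 < B v v) :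
    SmoothMetric I₆ G where
  inner := invForm B
  symm x u v := symm _ _
  pos x u hu := pos _ fun h ↦ hu ((coframeEquiv x).map_eq_zero_iff.1 h)
  isVonNBounded x := by
    have h := (isVonNBounded_of_pos symm pos).image
      (coframeEquiv x).symm.toContinuousLinearMap
    refine h.subset ?_
    intro u hu
    exact ⟨coframeEquiv x u, hu, (coframeEquiv x).symm_apply_apply u⟩
  contMDiff := contMDiff_invForm B

theorem invMetric_inner (symm : ∀ v w, B v w = B w v) (pos : ∀ v, v ≠ 0 → 0 < B v v) (x : G)
    (u v : TangentSpace I₆ x) :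
    (invMetric symm pos).inner x u v = B (coframeEquiv x u) (coframeEquiv x v) := rfl

theorem isLeftInvariant_invMetric (symm : ∀ v w, B v w = B w v) (pos : ∀ v, v ≠ 0 → 0 < B v v) :
    IsLeftInvariant (invMetric symm pos) := by
  intro h x u v
  rw [invMetric_inner, invMetric_inner, coframeEquiv_mul, coframeEquiv_mul]

end InvariantMetric

section Sufficiency

open VectorField

/-- The connection that differs from the flat connection of the left-invariant framing by the
left-invariant form `θ ⊗ K` with values in the endomorphisms. -/
def framedConnection (θ : LieAlg →L[ℝ] ℝ) (K : LieAlg →L[ℝ] LieAlg) : Connection I₆ G where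
  toFun Y x := (coframeEquiv x).symm.toContinuousLinearMap ∘L
    (mvfderiv I₆ (fun y ↦ coframeEquiv y (Y y)) x +
      (θ ∘L (coframeEquiv x).toContinuousLinearMap).smulRight (K (coframeEquiv x (Y x))))
  isCovariantDerivativeOnUniv :=
    { add := fun {Y Y' x} hY hY' _ ↦ by
        have h : (fun y ↦ coframeEquiv y ((Y + Y') y)) =
            (fun y ↦ coframeEquiv y (Y y)) + fun y ↦ coframeEquiv y (Y' y) :=
          funext fun y ↦ map_add (coframeEquiv y) _ _
        rw [h, mvfderiv_add (mdifferentiableAt_coframeEquiv hY)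
          (mdifferentiableAt_coframeEquiv hY')]
        ext1 u
        simp only [Pi.add_apply, map_add, ContinuousLinearMap.comp_apply,
          add_apply, ContinuousLinearMap.smulRight_apply, smul_add]
        abel
      leibniz := fun {Y f x} hY hf _ ↦ by
        have h : (fun y ↦ coframeEquiv y ((f • Y) y)) = f • (fun y ↦ coframeEquiv y (Y y)) :=
          funext fun y ↦ map_smul (coframeEquiv y) _ _
        rw [h, mvfderiv_smul hf (mdifferentiableAt_coframeEquiv hY)]
        ext1 u
        apply (coframeEquiv x).injective
        simp only [Pi.smul_apply', map_add, map_smul, ContinuousLinearMap.comp_apply,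
          add_apply, ContinuousLinearMap.smulRight_apply, smul_add,
          smul_apply, ContinuousLinearEquiv.coe_coe,
          ContinuousLinearEquiv.apply_symm_apply]
        rw [smul_comm (f x)]
        abel }

variable {θ : LieAlg →L[ℝ] ℝ} {K : LieAlg →L[ℝ] LieAlg}

theorem coframeEquiv_framedConnection (Y : VField I₆ G) (x : G) (u : TangentSpace I₆ x) :
    coframeEquiv x (framedConnection θ K Y x u) =
      mvfderiv I₆ (fun y ↦ coframeEquiv y (Y y)) x u +
        θ (coframeEquiv x u) • K (coframeEquiv x (Y x)) :=
  (coframeEquiv x).apply_symm_apply _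

theorem mvfderiv_coframeEquiv_framedConnection {Y Z : VField I₆ G} (hY : SmoothField Y)
    (hZ : SmoothField Z) (x : G) (u : TangentSpace I₆ x) :
    mvfderiv I₆ (fun y ↦ coframeEquiv y (framedConnection θ K Z y (Y y))) x u =
      mvfderiv I₆ (fun y ↦ mvfderiv I₆ (fun y ↦ coframeEquiv y (Z y)) y (Y y)) x u +
      (mvfderiv I₆ (fun y ↦ θ (coframeEquiv y (Y y))) x u • K (coframeEquiv x (Z x)) +
        θ (coframeEquiv x (Y x)) • K (mvfderiv I₆ (fun y ↦ coframeEquiv y (Z y)) x u)) := by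
  have hz := mdifferentiableAt_coframeEquiv (hZ.mdifferentiableAt x)
  have h1 : MDifferentiableAt I₆ 𝓘(ℝ, LieAlg)
      (fun y ↦ mvfderiv I₆ (fun y ↦ coframeEquiv y (Z y)) y (Y y)) x :=
    mdifferentiableAt_mvfderiv_apply hZ.contMDiff_coframeEquiv (hY.mdifferentiableAt x)
  have h2 := mdifferentiableAt_clm_comp θ
    (mdifferentiableAt_coframeEquiv (hY.mdifferentiableAt x))
  have h3 := mdifferentiableAt_clm_comp K hz
  have h4 : MDifferentiableAt I₆ 𝓘(ℝ, LieAlg)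
      (fun y ↦ θ (coframeEquiv y (Y y)) • K (coframeEquiv y (Z y))) x := h2.smul h3
  simp only [coframeEquiv_framedConnection]
  rw [mvfderiv_fun_add h1 h4, mvfderiv_fun_smul h2 h3]
  simp only [add_apply, smul_apply,
    ContinuousLinearMap.smulRight_apply]
  rw [mvfderiv_clm_comp K hz, add_comm (_ • _) (_ • _)]

/-- The curvature of `framedConnection θ K` takes values in the multiples of `K`. -/
theorem curvature_framedConnection {X Y Z : VField I₆ G} (hX : SmoothField X) (hY : SmoothField Y)
    (hZ : SmoothField Z) (x : G) :
    coframeEquiv x (curvature (framedConnection θ K) X Y Z x) =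
      (mvfderiv I₆ (fun y ↦ θ (coframeEquiv y (Y y))) x (X x) -
        mvfderiv I₆ (fun y ↦ θ (coframeEquiv y (X y))) x (Y x) -
        θ (coframeEquiv x (mlieBracket I₆ X Y x))) • K (coframeEquiv x (Z x)) := by
  rw [curvature, map_sub, map_sub]
  simp only [coframeEquiv_framedConnection (x := x)]
  rw [mvfderiv_coframeEquiv_framedConnection hY hZ, mvfderiv_coframeEquiv_framedConnection hX hZ,
    mlieBracket_apply_function hX hY hZ.contMDiff_coframeEquiv x]
  simp only [map_add, map_smul, smul_add, sub_smul]
  rw [smul_comm (θ (coframeEquiv x (X x))) (θ (coframeEquiv x (Y x)))]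
  abel

theorem exists_basis_of_orthonormal {V : Type*} [AddCommGroup V] [Module ℝ V]
    [FiniteDimensional ℝ V] {B : V →ₗ[ℝ] V →ₗ[ℝ] ℝ} {n : ℕ} (hn : Module.finrank ℝ V = n)
    {v : Fin n → V} (hv : ∀ i j, B (v i) (v j) = if i = j then 1 else 0) :
    ∃ e : Module.Basis (Fin n) ℝ V, ⇑e = v := by
  have hli : LinearIndependent ℝ v := by
    rw [Fintype.linearIndependent_iff]
    intro c hc i
    have := congrArg (fun w ↦ B w (v i)) hc
    simpa [hv] using this
  subst hn
  exact ⟨basisOfLinearIndependentOfCardEqFinrank' v hli (by simp),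
    coe_basisOfLinearIndependentOfCardEqFinrank' ..⟩

theorem ricciFormVanishes_framedConnection {a b : ℝ} {J : EndField I₆ G} (hJ : IsStructure a b J)
    {B : LieAlg →ₗ[ℝ] LieAlg →ₗ[ℝ] ℝ} (symm : ∀ v w, B v w = B w v)
    (pos : ∀ v, v ≠ 0 → 0 < B v v) (hB : ∀ v w, B (stdJ a b v) w = - B v (stdJ a b w))
    (hK : LinearMap.trace ℝ LieAlg (stdJ a b ∘ₗ (K : LieAlg →ₗ[ℝ] LieAlg)) = 0) :
    RicciFormVanishes J (invMetric symm pos) (framedConnection θ K) := by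
  intro X Y hX hY x e he heo
  simp only [invMetric_inner] at heo ⊢
  have hfin : Module.finrank ℝ LieAlg =
      Module.finrank ℝ (EuclideanSpace ℝ (Fin 3) × EuclideanSpace ℝ (Fin 3)) := by
    rw [Module.finrank_pi_fintype]
    simp
  obtain ⟨f, hf⟩ := exists_basis_of_orthonormal hfin (v := fun i ↦ coframeEquiv x (e i x)) heo
  have hf' : ∀ i, coframeEquiv x (e i x) = f i := fun i ↦ (congrFun hf i).symm
  simp only [hf'] at heo
  rw [trace_eq_sum_of_orthonormal heo] at hK
  simp only [curvature_framedConnection hX hY (he _), hJ.coframeEquiv_apply, map_smul,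
    LinearMap.smul_apply, ← Finset.smul_sum, hf']
  simp only [LinearMap.comp_apply, hB, ContinuousLinearMap.coe_coe, Finset.sum_neg_distrib,
    neg_eq_zero] at hK
  rw [hK, smul_zero]

theorem isBismut_framedConnection {a b : ℝ} {J : EndField I₆ G} (hJ : IsStructure a b J)
    {B : LieAlg →ₗ[ℝ] LieAlg →ₗ[ℝ] ℝ} (symm : ∀ v w, B v w = B w v)
    (pos : ∀ v, v ≠ 0 → 0 < B v v) (hBK : ∀ v w, B (K v) w + B v (K w) = 0)
    (hJK : ∀ v, K (stdJ a b v) = stdJ a b (K v))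
    (hT : ∀ u v w, B (θ u • K v - θ v • K u - lieBr u v) w =
      - B (θ u • K w - θ w • K u - lieBr u w) v) :
    IsBismut J (invMetric symm pos) (framedConnection θ K) where
  metric Y Z hY hZ x u := by
    have h := mvfderiv_bilinear B.toContinuousBilinearMap
      (mdifferentiableAt_coframeEquiv (hY.mdifferentiableAt x))
      (mdifferentiableAt_coframeEquiv (hZ.mdifferentiableAt x)) u
    simp only [LinearMap.toContinuousBilinearMap_apply] at h
    simp only [invMetric_inner, coframeEquiv_framedConnection]
    rw [h]
    have hk := hBK (coframeEquiv x (Y x)) (coframeEquiv x (Z x))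
    simp only [map_add, map_smul, LinearMap.add_apply, LinearMap.smul_apply, smul_eq_mul]
    linear_combination (-θ (coframeEquiv x u)) * hk
  complex Y hY x u := by
    apply (coframeEquiv x).injective
    have h := mvfderiv_clm_comp (LinearMap.toContinuousLinearMap (stdJ a b))
      (mdifferentiableAt_coframeEquiv (hY.mdifferentiableAt x)) u
    simp only [LinearMap.coe_toContinuousLinearMap'] at h
    rw [hJ.coframeEquiv_apply, coframeEquiv_framedConnection, coframeEquiv_framedConnection]
    simp only [hJ.coframeEquiv_apply]
    rw [h, hJK, map_add, map_smul]
  skew x u v w := by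
    have ht : ∀ u v : TangentSpace I₆ x,
        coframeEquiv x ((framedConnection θ K).torsion x u v) =
          θ (coframeEquiv x u) • K (coframeEquiv x v) -
            θ (coframeEquiv x v) • K (coframeEquiv x u) -
            lieBr (coframeEquiv x u) (coframeEquiv x v) := by
      intro u v
      have h := coframeEquiv_torsion_invField (framedConnection θ K) x (coframeEquiv x u)
        (coframeEquiv x v)
      simp only [christoffel_apply, coframeEquiv_framedConnection, coframeEquiv_invField,
        mvfderiv_const, invField_coframeEquiv] at h
      rw [h]
      simp [lieBrL_apply]
    rw [invMetric_inner, invMetric_inner, ht, ht, hT]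

/-- The inner product on the Lie algebra that gives a CYT metric. -/
def cytForm (a b r s : ℝ) : LieAlg →ₗ[ℝ] LieAlg →ₗ[ℝ] ℝ :=
  LinearMap.mk₂ ℝ (fun u v ↦ u 0 0 * v 0 0 + (a * u 0 0 + b * u 1 0) * (a * v 0 0 + b * v 1 0) +
      r * (u 0 1 * v 0 1 + u 0 2 * v 0 2) + s * (u 1 1 * v 1 1 + u 1 2 * v 1 2))
    (by intros; simp; ring) (by intros; simp; ring) (by intros; simp; ring)
    (by intros; simp; ring)

theorem cytForm_apply (a b r s : ℝ) (u v : LieAlg) : cytForm a b r s u v =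
    u 0 0 * v 0 0 + (a * u 0 0 + b * u 1 0) * (a * v 0 0 + b * v 1 0) +
      r * (u 0 1 * v 0 1 + u 0 2 * v 0 2) + s * (u 1 1 * v 1 1 + u 1 2 * v 1 2) := rfl

/-- Opposite rotations in the `(e^-, e^+)`-planes of the two factors. -/
def rotation : LieAlg →ₗ[ℝ] LieAlg where
  toFun f := ![![0, - f 0 2, f 0 1], ![0, f 1 2, - f 1 1]]
  map_add' := fun f k ↦ by
    ext i j
    fin_cases i <;> fin_cases j <;> simp <;> ring
  map_smul' := fun r f ↦ by
    ext i j
    fin_cases i <;> fin_cases j <;> simp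

theorem rotation_apply (f : LieAlg) :
    rotation f = ![![0, - f 0 2, f 0 1], ![0, f 1 2, - f 1 1]] := rfl

/-- The connection form of the Bismut connection of `cytForm`. -/
def cytConnectionForm (p q : ℝ) : LieAlg →ₗ[ℝ] ℝ where
  toFun f := p * f 0 0 + q * f 1 0
  map_add' := fun f k ↦ by simp; ring
  map_smul' := fun r f ↦ by simp; ring

theorem exists_isCYT {a b : ℝ} (hb : b ≠ 0) {J : EndField I₆ G} (hJ : IsStructure a b J)
    (h₁ : 0 < b * (b - a)) (h₂ : 0 < a ^ 2 + 1 - a * b) :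
    ∃ g : SmoothMetric I₆ G, IsLeftInvariant g ∧ IsCYT J g := by
  have hba : b - a ≠ 0 := right_ne_zero_of_mul h₁.ne'
  have hd : a ^ 2 + 1 - a * b ≠ 0 := h₂.ne'
  set r : ℝ := b / (b - a) with hr
  set s : ℝ := b ^ 2 / (a ^ 2 + 1 - a * b) with hs
  set p : ℝ := (a ^ 2 + 1) / r - 1 with hp
  set q : ℝ := a * b / r with hq
  have hr0 : 0 < r := by
    have : r = b * (b - a) / (b - a) ^ 2 := by rw [hr]; field_simp
    rw [this]
    positivity
  have hs0 : 0 < s := by positivity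
  have rp : r * p = a ^ 2 + 1 - r := by rw [hp]; field_simp
  have rq : r * q = a * b := by rw [hq]; field_simp
  have hsd : s * (a ^ 2 + 1 - a * b) = b ^ 2 := div_mul_cancel₀ _ hd
  have bp : b * p = - a * (a ^ 2 + 1 - a * b) := by rw [hp, hr]; field_simp; ring
  have q_eq : q = a * (b - a) := by rw [hq, hr]; field_simp
  have sp : s * p = - (a * b) := by
    apply mul_left_cancel₀ (mul_ne_zero hb hd)
    linear_combination b * p * hsd + b ^ 2 * bp
  have sq : s * q = s - b ^ 2 := by
    apply mul_left_cancel₀ hd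
    linear_combination (q - 1) * hsd + b ^ 2 * q_eq
  clear_value p q
  have symm : ∀ v w, cytForm a b r s v w = cytForm a b r s w v := fun v w ↦ by
    simp only [cytForm_apply]; ring
  have pos : ∀ v, v ≠ 0 → 0 < cytForm a b r s v v := by
    intro v hv
    by_contra! hle
    rw [cytForm_apply] at hle
    have e1 := mul_self_nonneg (v 0 0)
    have e2 := mul_self_nonneg (a * v 0 0 + b * v 1 0)
    have e3 := mul_nonneg hr0.le (mul_self_nonneg (v 0 1))
    have e4 := mul_nonneg hr0.le (mul_self_nonneg (v 0 2))
    have e5 := mul_nonneg hs0.le (mul_self_nonneg (v 1 1))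
    have e6 := mul_nonneg hs0.le (mul_self_nonneg (v 1 2))
    have z1 : v 0 0 = 0 := mul_self_eq_zero.1 (by linarith)
    have z2 : a * v 0 0 + b * v 1 0 = 0 := mul_self_eq_zero.1 (by linarith)
    have z3 : r * (v 0 1 * v 0 1) = 0 := by linarith
    have z4 : r * (v 0 2 * v 0 2) = 0 := by linarith
    have z5 : s * (v 1 1 * v 1 1) = 0 := by linarith
    have z6 : s * (v 1 2 * v 1 2) = 0 := by linarith
    rw [z1] at z2
    simp [hb, hr0.ne', hs0.ne'] at z2 z3 z4 z5 z6
    apply hv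
    ext i j
    fin_cases i <;> fin_cases j <;> simp [*]
  have hB : ∀ v w, cytForm a b r s (stdJ a b v) w = - cytForm a b r s v (stdJ a b w) := by
    intro v w
    simp only [cytForm_apply, stdJ_apply]
    simp
    field_simp
    ring
  refine ⟨invMetric symm pos, isLeftInvariant_invMetric symm pos, fun x u v ↦ ?_,
    framedConnection (LinearMap.toContinuousLinearMap (cytConnectionForm p q))
      (LinearMap.toContinuousLinearMap rotation), ?_, ?_⟩
  · rw [invMetric_inner, invMetric_inner, hJ.coframeEquiv_apply, hJ.coframeEquiv_apply, hB,
      stdJ_stdJ a hb, map_neg, neg_neg]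
  · refine isBismut_framedConnection hJ symm pos (fun v w ↦ ?_) (fun v ↦ ?_) (fun u v w ↦ ?_)
    · simp [cytForm_apply, rotation_apply]
      ring
    · ext i j
      fin_cases i <;> fin_cases j <;> simp [rotation_apply, stdJ_apply]
    · simp only [map_sub, map_smul, LinearMap.sub_apply, LinearMap.smul_apply, smul_eq_mul,
        cytForm_apply]
      simp [rotation_apply, lieBr, cytConnectionForm]
      linear_combination
        (-(v 0 0 * (u 0 1 * w 0 2 - u 0 2 * w 0 1) +
          w 0 0 * (u 0 1 * v 0 2 - u 0 2 * v 0 1))) * rp +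
        (-(v 1 0 * (u 0 1 * w 0 2 - u 0 2 * w 0 1) +
          w 1 0 * (u 0 1 * v 0 2 - u 0 2 * v 0 1))) * rq +
        (v 0 0 * (u 1 1 * w 1 2 - u 1 2 * w 1 1) + w 0 0 * (u 1 1 * v 1 2 - u 1 2 * v 1 1)) * sp +
        (v 1 0 * (u 1 1 * w 1 2 - u 1 2 * w 1 1) + w 1 0 * (u 1 1 * v 1 2 - u 1 2 * v 1 1)) * sq
  · refine ricciFormVanishes_framedConnection hJ symm pos hB ?_
    rw [trace_lieAlg]
    simp [Fin.sum_univ_three, rotation_apply, stdJ_apply]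

end Sufficiency

end CYT

end

theorem proposition3 (a b : ℝ) (hb : b ≠ 0) (J : CYT.EndField CYT.I₆ CYT.G)
    (hJ : CYT.IsStructure a b J) :
    (∃ g : CYT.SmoothMetric CYT.I₆ CYT.G, CYT.IsLeftInvariant g ∧ CYT.IsCYT J g) ↔
      0 < b * (b - a) ∧ 0 < a ^ 2 + 1 - a * b :=
  ⟨fun ⟨_, hg, h⟩ ↦ CYT.inequalities_of_isCYT hb hJ hg h,
    fun ⟨h₁, h₂⟩ ↦ CYT.exists_isCYT hb hJ h₁ h₂⟩
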